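/- Fix integers $K,M$ with $1<M\le K$. A server stores $K$ messages $W_1,\dots,W_K$, i.i.d. uniform on $\mathbb{F}_q^L$. Let $\mathcal S$ be a uniformly random $M$-element subset of $[K]$, let $\theta$ be uniform on $\mathcal S$, let $\Lambda=(\lambda_1,\dots,\lambda_M)$ be uniform on $(\mathbb{F}_q^\times)^M$, with $(\theta,\mathcal S)$, $\Lambda$, $(W_1,\dots,W_K)$ independent, and let the coded side information be $Y^{[\mathcal S,\Lambda]}=\sum_{m=1}^M\lambda_m W_{\mathcal S(m)}$, where $\mathcal S(m)$ is the $m$-th smallest element of $\mathcal S$. A scheme consists of a random (discrete) query $Q$ with $I(W_{[K]};Q,\theta,\mathcal S,\Lambda)=0$ and an answer $\Delta$ that is a function of $(Q,W_{[K]})$, given as a string of symbols of $\mathbb{F}_q$ (prefix-free for each query). It is private if $I(\theta,\mathcal S;Q,W_{[K]})=0$, and correct if $H(W_\theta\mid\Delta,Q,Y^{[\mathcal S,\Lambda]},\mathcal S,\Lambda,\theta)=0$. Its rate is $L/D$, where $D$ is the expected length of $\Delta$. The capacity $C(q)$ is the supremum of the rates of private correct schemes over all $L\ge1$, and $C^{\sup}=\sup_q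 C(q)$ over all finite fields (PIR-PCSI-II). For $\alpha\in\mathbb{R}$ let $\overline C(q,\alpha)$ be the supremum of the rates over all $L\ge 1$, all families of functions $(f_{S,\Lambda})$ on $\mathbb{F}_q^L$ with $\max_{S,\Lambda}H(f_{S,\Lambda}(Y^{[S,\Lambda]}))/L\le\alpha$ (entropy in $q$-ary units), and all private schemes that are correct when $Y^{[\mathcal S,\Lambda]}$ is replaced by $f_{\mathcal S,\Lambda}(Y^{[\mathcal S,\Lambda]})$ in the correctness condition. Say that $\alpha$-CSI is sufficient if $\sup_q\overline C(q,\alpha)=C^{\sup}$, let $\alpha^*$ be the smallest $\alpha$ such that $\alpha$-CSI is sufficient, and let the redundancy be $\rho=1-\alpha^*$. Then the smallest sufficient $\alpha$ exists, and $$\rho=\begin{cases}1/2, & 1<M\le (K+2)/2,\\ 0, & (K+2)/2<M\le K.\end{cases}$$ That is: if $1<M\le(K+2)/2$, then $\tfrac12$-CSI is sufficient and $\sup_q\overline C(q,\alpha)<C^{\sup}$ for every $\alpha<\tfrac12$; if $(K+2)/2<M\le K$, then $1$-CSI is sufficient and $\sup_q\overline C(q,\alpha)<C^{\sup}$ for every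 $\alpha<1$. -/

import Mathlib

open scoped ENNReal

noncomputable section

namespace PCSI

/-- The collection of all `M`-element subsets of the message indices. -/
abbrev Support (K M : ℕ) : Type := {S : Finset (Fin K) // S.card = M}

/-- Coefficient vectors: length-`M` sequences of nonzero field elements. -/
abbrev Coeff (M : ℕ) (F : Type) [Field F] : Type := Fin M → Fˣ

/-- The contents of the server: `K` messages, each made of `L` symbols of the base field. -/
abbrev Messages (K L : ℕ) (F : Type) : Type := Fin K → Fin L → F

/-- The coded side information `∑ₘ λₘ W_{S(m)}`, where `S(m)` is the `m`-th element of `S`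
in ascending order. -/
def sideInfo {K M L : ℕ} {F : Type} [Field F] (S : Support K M) (c : Coeff M F)
    (W : Messages K L F) : Fin L → F :=
  ∑ m : Fin M, (c m : F) • W (S.1.orderEmbOfFin S.2 m)

/-- A joint realization of all the random variables of the problem: the demand index `θ`,
the support `S` and the coefficients `Λ` of the side information, the messages, the query. -/
structure Outcome (K M L : ℕ) (F : Type) [Field F] (𝒬 : Type) where
  θ : Fin K
  S : Support K M
  Λ : Coeff M F
  W : Messages K L F
  Q : 𝒬

/-- Independence of two discrete random variables, i.e. `I(X; Y) = 0`. -/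
def Indep {Ω α β : Type} (μ : PMF Ω) (X : Ω → α) (Y : Ω → β) : Prop :=
  ∀ x y, μ.map (fun ω => (X ω, Y ω)) (x, y) = μ.map X x * μ.map Y y

/-- `Y` is almost surely a function of `X`, i.e. `H(Y | X) = 0`. -/
def Determines {Ω α β : Type} (μ : PMF Ω) (X : Ω → α) (Y : Ω → β) : Prop :=
  ∀ ω ∈ μ.support, ∀ ω' ∈ μ.support, X ω = X ω' → Y ω = Y ω'

/-- A query-answer protocol for message length `L` over the base field `F`, for the formulation
in which the demand is uniform on the support of the side information. Privacy and correctness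
are separate predicates below. -/
structure Scheme (K M L : ℕ) (F : Type) [Field F] where
  /-- The query alphabet. -/
  Query : Type
  /-- The joint law of `(θ, S, Λ, W, Q)`. -/
  law : PMF (Outcome K M L F Query)
  /-- `S` is uniform on the `M`-subsets, `θ` is uniform on `S`, the coefficients are uniform,
  the messages are i.i.d. uniform, and `(θ, S)`, `Λ`, `W` are independent. -/
  setup : ∀ (θ : Fin K) (S : Support K M) (Λ : Coeff M F) (W : Messages K L F),
    law.map (fun ω => (ω.θ, ω.S, ω.Λ, ω.W)) (θ, S, Λ, W) =
      (Nat.card (Support K M) : ℝ≥0∞)⁻¹ * (if θ ∈ S.1 then (M : ℝ≥0∞)⁻¹ else 0) *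
        (Nat.card (Coeff M F) : ℝ≥0∞)⁻¹ * (Nat.card (Messages K L F) : ℝ≥0∞)⁻¹
  /-- `I(W; Q, θ, S, Λ) = 0`. -/
  query_indep : Indep law (fun ω => ω.W) (fun ω => (ω.Q, ω.θ, ω.S, ω.Λ))
  /-- The server's answer, a string of symbols of `F` that is a function of the query and
  the messages. -/
  answer : Query → Messages K L F → List F
  /-- The length of an answer may depend on the query and on the messages; for a given query no
  possible answer is a proper prefix of another one, so that the number of downloaded symbols
  accounts for all the downloaded information. -/
  prefix_free : ∀ Q W W', answer Q W <+: answer Q W' → answer Q W = answer Q W'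

namespace Scheme

variable {K M L : ℕ} {F : Type} [Field F]

/-- `(θ, S)`-privacy: `I(θ, S; Q, W) = 0`. -/
def IsPrivate (Z : Scheme K M L F) : Prop :=
  Indep Z.law (fun ω => (ω.θ, ω.S)) (fun ω => (ω.Q, ω.W))

/-- Correctness when the user retains only `f S Λ Y` of the side information `Y`:
`H(W_θ | Δ, Q, f S Λ Y, S, Λ, θ) = 0`. -/
def IsCorrect (Z : Scheme K M L F) {A : Type}
    (f : Support K M → Coeff M F → (Fin L → F) → A) : Prop :=
  Determines Z.law
    (fun ω => (Z.answer ω.Q ω.W, ω.Q, f ω.S ω.Λ (sideInfo ω.S ω.Λ ω.W), ω.S, ω.Λ, ω.θ))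
    (fun ω => ω.W ω.θ)

/-- The average number `D` of downloaded symbols of `F`. -/
def download (Z : Scheme K M L F) : ℝ≥0∞ :=
  ∑' ω, Z.law ω * ((Z.answer ω.Q ω.W).length : ℝ≥0∞)

/-- The rate `L / D`. -/
def rate (Z : Scheme K M L F) : ℝ≥0∞ := (L : ℝ≥0∞) / Z.download

end Scheme

open Classical in
/-- The Shannon entropy, in base `q`, of `X ω` for `ω` uniform on the finite set `Ω`. -/
def entropy {Ω α : Type} [Fintype Ω] (q : ℕ) (X : Ω → α) : ℝ :=
  ∑ x ∈ Finset.univ.image X,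
    Real.negMulLog (((Finset.univ.filter fun ω => X ω = x).card : ℝ) / Fintype.card Ω) / Real.log q

/-- The family `f` of functions, applied to the side information of every support and every
coefficient vector, uses no more than `α`-CSI: `max_{S, Λ} H(f S Λ Y) / L ≤ α`. -/
def UsesAtMost {K M L : ℕ} {F : Type} [Field F] [Fintype F] {A : Type}
    (f : Support K M → Coeff M F → (Fin L → F) → A) (α : ℝ) : Prop :=
  ∀ (S : Support K M) (Λ : Coeff M F),
    entropy (Fintype.card F) (fun W : Messages K L F => f S Λ (sideInfo S Λ W)) / L ≤ α

/-- The supremum of the rates of private schemes of message length `L` over `F` that decode from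
`f S Λ Y` instead of `Y`. -/
def reducedCapacity {K M L : ℕ} {F : Type} [Field F] {A : Type}
    (f : Support K M → Coeff M F → (Fin L → F) → A) : ℝ≥0∞ :=
  ⨆ (Z : Scheme K M L F) (_ : Z.IsPrivate) (_ : Z.IsCorrect f), Z.rate

/-- The capacity over the field `F`: the supremum of achievable rates over all message sizes. -/
def capacity (K M : ℕ) (F : Type) [Field F] : ℝ≥0∞ :=
  ⨆ (L : ℕ) (_ : 0 < L),
    reducedCapacity (K := K) (M := M) (L := L) (F := F) (fun _ _ Y => Y)

/-- The `α`-CSI constrained capacity over the finite field `F`. -/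
def constrainedCapacity (K M : ℕ) (F : Type) [Field F] [Fintype F] (α : ℝ) : ℝ≥0∞ :=
  ⨆ (L : ℕ) (_ : 0 < L) (A : Type) (f : Support K M → Coeff M F → (Fin L → F) → A)
    (_ : UsesAtMost f α), reducedCapacity f

/-- The supremum capacity: the supremum of the capacity over all finite fields. -/
def supCapacity (K M : ℕ) : ℝ≥0∞ :=
  ⨆ (F : Type) (_ : Field F) (_ : Fintype F), capacity K M F

/-- The supremum over all finite fields of the `α`-CSI constrained capacity. -/
def supConstrainedCapacity (K M : ℕ) (α : ℝ) : ℝ≥0∞ :=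
  ⨆ (F : Type) (_ : Field F) (_ : Fintype F), constrainedCapacity K M F α

/-- `α`-CSI is sufficient: it entails no loss in the supremum capacity. -/
def IsSufficient (K M : ℕ) (α : ℝ) : Prop :=
  supConstrainedCapacity K M α = supCapacity K M

/-- The redundancy `1 - α*`, where `α*` is the least sufficient `α` (that the infimum is attained
is to be asserted separately). -/
def redundancy (K M : ℕ) : ℝ := 1 - sInf {α : ℝ | IsSufficient K M α}

end PCSI

end

/-! Converse. Fix a possible query; the answer `Δ` becomes a function of the messages. Privacy makes
every pair `(θ, S)` compatible with this query, so from the one answer each message of each support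
is decodable using suitable side information (`DecodesFrom`). By the chain rule `H(Δ) = K L log q -
∑ a k`, where `a k` is the entropy of message `k` given `Δ` and the earlier messages, and a
prefix-free answer is at least as long as its entropy. So upper bounds on the `a k` bound the
download from below.

There are two such bounds. Retained side information of entropy at most `α L log q` gives `a k ≤ α L
log q`. Moreover `a j + a k ≤ L log q` for `j < k` with `k ≥ M - 1` (`chainTerm_pair_le`): choose a
support containing `j` whose largest element is `k`; given `Δ`, its side information `Y` reveals
message `j`, and with the other messages of the support it also reveals message `k`. For `2M ≤ K +
2` all indices can be paired, so `D/L ≥ K/2`, while the first bound gives `D/L ≥ K(1 - α)`.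
Otherwise `K - M + 1` pairs and `2M - K - 2` single indices give `D/L ≥ (K - M + 1) + (2M - K - 2)(1
- α)`.

Achievability. The query is a uniform key `d` of nonzero scalars, and `Λ` is `d` on the support up
to fixed factors, one of which carries an extra `β ≠ 1` at the demand. Over the field of four
elements, half of every `d k • W k` is downloaded; the same half of `Y` then yields the half of `β •
d θ • W θ`, which completes the demand, at rate `2/K` (`eq_of_projections`). Over a large prime
field, `K - M + 1` power sums yield a combination supported on `S` that differs from `Y` only at the
demand (`eq_of_powerSums`). -/

noncomputable section

namespace PCSI

/-! ### Entropy of functions on a finite uniform space -/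

section UniformEntropy

variable {Ω α β γ δ : Type} [Fintype Ω]

open Classical in
/-- The number of points of `Ω` at which `X` takes the same value as at `ω`. -/
def fiberCard (X : Ω → α) (ω : Ω) : ℝ := ((Finset.univ.filter fun ω' => X ω' = X ω).card : ℝ)

/-- The Shannon entropy, in nats, of `X ω` for `ω` uniform on `Ω`. -/
def unifEntropy (X : Ω → α) : ℝ :=
  (∑ ω, Real.log (Fintype.card Ω / fiberCard X ω)) / Fintype.card Ω

lemma fiberCard_pos (X : Ω → α) (ω : Ω) : 0 < fiberCard X ω := by
  classical
  unfold fiberCard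
  exact_mod_cast Finset.card_pos.2 ⟨ω, by simp⟩

open Classical in
lemma fiberCard_eq_sum (X : Ω → α) (ω : Ω) :
    fiberCard X ω = ∑ ω', if X ω' = X ω then (1 : ℝ) else 0 := by
  simp [fiberCard]

lemma fiberCard_congr (X : Ω → α) {ω ω' : Ω} (h : X ω = X ω') :
    fiberCard X ω = fiberCard X ω' := by
  simp only [fiberCard, h]
  congr!

lemma sum_log_nonpos (t : Ω → ℝ) (ht : ∀ ω, 0 < t ω) (h : ∑ ω, t ω ≤ Fintype.card Ω) :
    ∑ ω, Real.log (t ω) ≤ 0 := by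
  calc ∑ ω, Real.log (t ω) ≤ ∑ ω, (t ω - 1) :=
        Finset.sum_le_sum fun ω _ => Real.log_le_sub_one_of_pos (ht ω)
    _ ≤ 0 := by simp [h]

lemma unifEntropy_mono {X : Ω → α} {Y : Ω → β} (h : ∀ ω ω', X ω = X ω' → Y ω = Y ω') :
    unifEntropy Y ≤ unifEntropy X := by
  classical
  unfold unifEntropy
  gcongr with ω
  · exact div_pos (Nat.cast_pos.2 (Fintype.card_pos_iff.2 ⟨ω⟩)) (fiberCard_pos _ _)
  · exact fiberCard_pos _ _
  · unfold fiberCard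
    gcongr with ω'
    exact h ω' ω

lemma unifEntropy_congr {X : Ω → α} {Y : Ω → β} (h : ∀ ω ω', X ω = X ω' ↔ Y ω = Y ω') :
    unifEntropy X = unifEntropy Y :=
  le_antisymm (unifEntropy_mono fun ω ω' => (h ω ω').2) (unifEntropy_mono fun ω ω' => (h ω ω').1)

/-- The sum of `1 / fiberCard Z` over each fibre of `Z` is one. -/
lemma sum_inv_fiberCard_eq_one (Z : Ω → α) (ω : Ω) [∀ ω', Decidable (Z ω' = Z ω)] :
    ∑ ω', (if Z ω' = Z ω then (fiberCard Z ω)⁻¹ else 0) = 1 := by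
  rw [← Finset.sum_filter, Finset.sum_const, nsmul_eq_mul]
  have : (((Finset.univ.filter fun ω' => Z ω' = Z ω).card : ℕ) : ℝ) = fiberCard Z ω := by
    unfold fiberCard
    congr!
  rw [this, mul_inv_cancel₀ (fiberCard_pos _ _).ne']

/-- Submodularity of entropy: if `X` and `Y` both determine `Z` and together determine `V`, then
`H(V) + H(Z) ≤ H(X) + H(Y)`. -/
lemma unifEntropy_submodular {X : Ω → α} {Y : Ω → β} {Z : Ω → γ} {V : Ω → δ}
    (hXZ : ∀ ω ω', X ω = X ω' → Z ω = Z ω') (hYZ : ∀ ω ω', Y ω = Y ω' → Z ω = Z ω')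
    (hV : ∀ ω ω', X ω = X ω' → Y ω = Y ω' → V ω = V ω') :
    unifEntropy V + unifEntropy Z ≤ unifEntropy X + unifEntropy Y := by
  classical
  -- `log t` is the pointwise value of `H(V) + H(Z) - H(X) - H(Y)`, so by `log t ≤ t - 1` it
  -- suffices that `t` has mean at most one.
  let t : Ω → ℝ := fun ω => fiberCard X ω * fiberCard Y ω / (fiberCard V ω * fiberCard Z ω)
  have ht : ∀ ω, 0 < t ω := fun ω =>
    div_pos (mul_pos (fiberCard_pos _ _) (fiberCard_pos _ _))
      (mul_pos (fiberCard_pos _ _) (fiberCard_pos _ _))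
  -- The product of fibre sizes in `t` counts pairs `(ω₁, ω₂)` agreeing with `ω` in `X` and in `Y`.
  -- For a fixed pair all such `ω` lie in one fibre of `V`, which cancels `fiberCard V`, and such
  -- `ω` exist only if `Z` agrees on the pair.
  have key : ∀ ω₁ ω₂ : Ω, ∑ ω, (if X ω₁ = X ω then (1 : ℝ) else 0) *
      (if Y ω₂ = Y ω then 1 else 0) / (fiberCard V ω * fiberCard Z ω) ≤
      if Z ω₂ = Z ω₁ then (fiberCard Z ω₁)⁻¹ else 0 := by
    intro ω₁ ω₂
    by_cases hex : ∃ ω, X ω₁ = X ω ∧ Y ω₂ = Y ω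
    · obtain ⟨ω₀, h1, h2⟩ := hex
      have hz1 := hXZ _ _ h1
      have hz2 := hYZ _ _ h2
      rw [if_pos (hz2.trans hz1.symm), fiberCard_congr Z hz1]
      calc ∑ ω, (if X ω₁ = X ω then (1 : ℝ) else 0) *
            (if Y ω₂ = Y ω then 1 else 0) / (fiberCard V ω * fiberCard Z ω)
          ≤ ∑ ω, (if V ω = V ω₀ then (fiberCard V ω₀)⁻¹ else 0) * (fiberCard Z ω₀)⁻¹ := by
            refine Finset.sum_le_sum fun ω _ => ?_
            by_cases hx : X ω₁ = X ω
            · by_cases hy : Y ω₂ = Y ω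
              · have hv := hV ω ω₀ (hx.symm.trans h1) (hy.symm.trans h2)
                have hz := hXZ _ _ (hx.symm.trans h1)
                rw [if_pos hx, if_pos hy, if_pos hv, fiberCard_congr V hv, fiberCard_congr Z hz]
                simp [div_eq_mul_inv, mul_comm]
              · rw [if_neg hy]
                have := (fiberCard_pos V ω₀).le
                have := (fiberCard_pos Z ω₀).le
                simp only [mul_zero, zero_div]
                positivity
            · rw [if_neg hx]
              have := (fiberCard_pos V ω₀).le
              have := (fiberCard_pos Z ω₀).le
              simp only [zero_mul, zero_div]
              positivity
        _ = (fiberCard Z ω₀)⁻¹ := by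
            rw [← Finset.sum_mul, sum_inv_fiberCard_eq_one, one_mul]
    · have : ∀ ω, (if X ω₁ = X ω then (1 : ℝ) else 0) *
          (if Y ω₂ = Y ω then 1 else 0) / (fiberCard V ω * fiberCard Z ω) = 0 := by
        intro ω
        by_cases hx : X ω₁ = X ω
        · rw [if_neg (fun hy => hex ⟨ω, hx, hy⟩)]; simp
        · rw [if_neg hx]; simp
      rw [Finset.sum_eq_zero fun ω _ => this ω]
      have := (fiberCard_pos Z ω₁).le
      positivity
  have hsum : ∑ ω, t ω ≤ Fintype.card Ω := by
    calc ∑ ω, t ω = ∑ ω, ∑ ω₁, ∑ ω₂, (if X ω₁ = X ω then (1 : ℝ) else 0) *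
            (if Y ω₂ = Y ω then 1 else 0) / (fiberCard V ω * fiberCard Z ω) := by
          refine Finset.sum_congr rfl fun ω _ => ?_
          simp only [t]
          rw [fiberCard_eq_sum X, fiberCard_eq_sum Y, Finset.sum_mul_sum, Finset.sum_div]
          exact Finset.sum_congr rfl fun _ _ => Finset.sum_div _ _ _
      _ = ∑ ω₁, ∑ ω₂, ∑ ω, (if X ω₁ = X ω then (1 : ℝ) else 0) *
            (if Y ω₂ = Y ω then 1 else 0) / (fiberCard V ω * fiberCard Z ω) := by
          rw [Finset.sum_comm]
          exact Finset.sum_congr rfl fun _ _ => Finset.sum_comm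
      _ ≤ ∑ ω₁, ∑ ω₂, (if Z ω₂ = Z ω₁ then (fiberCard Z ω₁)⁻¹ else 0) :=
          Finset.sum_le_sum fun ω₁ _ => Finset.sum_le_sum fun ω₂ _ => key ω₁ ω₂
      _ = Fintype.card Ω := by simp [sum_inv_fiberCard_eq_one]
  have hlog := sum_log_nonpos t ht hsum
  have hsplit : ∀ ω, Real.log (t ω) =
      (Real.log (Fintype.card Ω / fiberCard V ω) + Real.log (Fintype.card Ω / fiberCard Z ω)) -
      (Real.log (Fintype.card Ω / fiberCard X ω) + Real.log (Fintype.card Ω / fiberCard Y ω)) := by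
    intro ω
    have hc : (Fintype.card Ω : ℝ) ≠ 0 := Nat.cast_ne_zero.2 (Fintype.card_pos_iff.2 ⟨ω⟩).ne'
    have h1 := (fiberCard_pos X ω).ne'
    have h2 := (fiberCard_pos Y ω).ne'
    have h3 := (fiberCard_pos V ω).ne'
    have h4 := (fiberCard_pos Z ω).ne'
    simp only [t]
    rw [Real.log_div (mul_ne_zero h1 h2) (mul_ne_zero h3 h4), Real.log_mul h1 h2,
      Real.log_mul h3 h4, Real.log_div hc h1, Real.log_div hc h2, Real.log_div hc h3,
      Real.log_div hc h4]
    ring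
  unfold unifEntropy
  rw [← add_div, ← add_div]
  gcongr ?_ / _
  rw [← Finset.sum_add_distrib, ← Finset.sum_add_distrib, ← sub_nonpos, ← Finset.sum_sub_distrib,
    ← Finset.sum_congr rfl fun ω _ => hsplit ω]
  exact hlog

lemma unifEntropy_const [Nonempty Ω] (X : Ω → α) (h : ∀ ω ω', X ω = X ω') :
    unifEntropy X = 0 := by
  classical
  have : ∀ ω, fiberCard X ω = Fintype.card Ω := fun ω => by
    simp [fiberCard, fun ω' => h ω' ω]
  simp [unifEntropy, this]

lemma unifEntropy_of_injective [Nonempty Ω] {X : Ω → α} (h : Function.Injective X) :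
    unifEntropy X = Real.log (Fintype.card Ω) := by
  classical
  have : ∀ ω, fiberCard X ω = 1 := fun ω => by
    have : (Finset.univ.filter fun ω' => X ω' = X ω) = {ω} := by
      ext ω'; simp [h.eq_iff]
    simp [fiberCard, this]
  simp [unifEntropy, this]

/-- Subadditivity: if `X` and `Y` together determine `V`, then `H(V) ≤ H(X) + H(Y)`. -/
lemma unifEntropy_subadditive [Nonempty Ω] {X : Ω → α} {Y : Ω → β} {V : Ω → δ}
    (hV : ∀ ω ω', X ω = X ω' → Y ω = Y ω' → V ω = V ω') :
    unifEntropy V ≤ unifEntropy X + unifEntropy Y := by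
  have h := unifEntropy_submodular (Z := fun _ : Ω => ()) (fun _ _ _ => rfl) (fun _ _ _ => rfl) hV
  rwa [unifEntropy_const (fun _ : Ω => ()) (fun _ _ => rfl), add_zero] at h

lemma sum_inv_fiberCard [DecidableEq α] (X : Ω → α) (g : α → ℝ) :
    ∑ ω, g (X ω) * (fiberCard X ω)⁻¹ = ∑ x ∈ Finset.univ.image X, g x := by
  have h := Finset.sum_comp (s := (Finset.univ : Finset Ω))
    (fun x => g x * (((Finset.univ.filter fun ω' => X ω' = x).card : ℝ))⁻¹) X
  have h2 : ∀ ω, fiberCard X ω = ((Finset.univ.filter fun ω' => X ω' = X ω).card : ℝ) := by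
    intro ω; unfold fiberCard; congr!
  simp only [h2]
  rw [h]
  refine Finset.sum_congr rfl fun x hx => ?_
  obtain ⟨ω, -, rfl⟩ := Finset.mem_image.1 hx
  rw [← h2, nsmul_eq_mul, ← h2]
  field_simp [(fiberCard_pos X ω).ne']

/-- Gibbs' inequality: a sub-probability weight on the values of `X` bounds its entropy. -/
lemma unifEntropy_le_of_weight [DecidableEq α] (X : Ω → α) (g : α → ℝ)
    (hg : ∀ ω, 0 < g (X ω)) (hsum : ∑ x ∈ Finset.univ.image X, g x ≤ 1) :
    unifEntropy X ≤ (∑ ω, -Real.log (g (X ω))) / Fintype.card Ω := by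
  unfold unifEntropy
  gcongr ?_ / _
  rw [← sub_nonpos, ← Finset.sum_sub_distrib]
  have := sum_log_nonpos (fun ω => Fintype.card Ω * (g (X ω) * (fiberCard X ω)⁻¹)) (fun ω =>
    mul_pos (Nat.cast_pos.2 (Fintype.card_pos_iff.2 ⟨ω⟩))
      (mul_pos (hg ω) (inv_pos.2 (fiberCard_pos _ _)))) (by
    rw [← Finset.mul_sum, sum_inv_fiberCard]
    exact mul_le_of_le_one_right (Nat.cast_nonneg _) hsum)
  refine le_trans (le_of_eq (Finset.sum_congr rfl fun ω _ => ?_)) this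
  have hc : (Fintype.card Ω : ℝ) ≠ 0 := Nat.cast_ne_zero.2 (Fintype.card_pos_iff.2 ⟨ω⟩).ne'
  have h1 := (fiberCard_pos X ω).ne'
  rw [Real.log_div hc h1, Real.log_mul hc (mul_ne_zero (hg ω).ne' (inv_ne_zero h1)),
    Real.log_mul (hg ω).ne' (inv_ne_zero h1), Real.log_inv]
  ring

lemma unifEntropy_le_log_card [Nonempty Ω] [Fintype α] (X : Ω → α) :
    unifEntropy X ≤ Real.log (Fintype.card α) := by
  classical
  obtain ⟨ω₀⟩ := ‹Nonempty Ω›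
  have hα : 0 < (Fintype.card α : ℝ) := Nat.cast_pos.2 (Fintype.card_pos_iff.2 ⟨X ω₀⟩)
  have h := unifEntropy_le_of_weight X (fun _ => (Fintype.card α : ℝ)⁻¹)
    (fun _ => inv_pos.2 hα) (by
      rw [Finset.sum_const, nsmul_eq_mul, ← div_eq_mul_inv, div_le_one hα]
      exact_mod_cast Finset.card_le_univ _)
  refine h.trans (le_of_eq ?_)
  have hc : (Fintype.card Ω : ℝ) ≠ 0 := Nat.cast_ne_zero.2 (Fintype.card_pos_iff.2 ⟨ω₀⟩).ne'
  simp [Real.log_inv, hc]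

/-- Spreading the term of each value evenly over its fibre turns the sum over values into a sum over
outcomes. -/
lemma entropy_eq_unifEntropy (q : ℕ) (X : Ω → α) :
    entropy q X = unifEntropy X / Real.log q := by
  classical
  unfold entropy
  rw [← Finset.sum_div]
  congr 1
  rw [← sum_inv_fiberCard X (fun x => Real.negMulLog
    (((Finset.univ.filter fun ω => X ω = x).card : ℝ) / Fintype.card Ω)), unifEntropy,
    Finset.sum_div]
  refine Finset.sum_congr rfl fun ω _ => ?_
  change Real.negMulLog (fiberCard X ω / Fintype.card Ω) * (fiberCard X ω)⁻¹ = _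
  have h1 := (fiberCard_pos X ω).ne'
  have hc : (Fintype.card Ω : ℝ) ≠ 0 := Nat.cast_ne_zero.2 (Fintype.card_pos_iff.2 ⟨ω⟩).ne'
  rw [Real.negMulLog, Real.log_div h1 hc, Real.log_div hc h1]
  field_simp
  ring

end UniformEntropy

/-! ### Kraft's inequality and the length of prefix-free answers -/

section PrefixCode

/-- The first codewords of two equal concatenations are prefixes of one string, hence comparable,
hence equal; cancel and induct. The empty word must be excluded because concatenation does not see
it. -/
lemma uniquelyDecodable_of_prefixFree {α : Type} {S : Set (List α)} (hnil : [] ∉ S)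
    (hS : ∀ u ∈ S, ∀ v ∈ S, u <+: v → u = v) : InformationTheory.UniquelyDecodable S := by
  intro L₁
  induction L₁ with
  | nil =>
    intro L₂ _ h₂ h
    cases L₂ with
    | nil => rfl
    | cons v L₂ =>
      have hv : v = [] := by
        simp only [List.flatten_nil, List.flatten_cons] at h
        exact (List.append_eq_nil_iff.1 h.symm).1
      exact absurd (hv ▸ h₂ v (by simp)) hnil
  | cons u L₁ ih =>
    intro L₂ h₁ h₂ h
    cases L₂ with
    | nil =>
      have hu : u = [] := by
        simp only [List.flatten_nil, List.flatten_cons] at h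
        exact (List.append_eq_nil_iff.1 h).1
      exact absurd (hu ▸ h₁ u (by simp)) hnil
    | cons v L₂ =>
      simp only [List.flatten_cons] at h
      have hu := h₁ u (by simp)
      have hv := h₂ v (by simp)
      have huv : u = v := by
        have p1 : u <+: u ++ L₁.flatten := List.prefix_append _ _
        have p2 : v <+: u ++ L₁.flatten := h ▸ List.prefix_append _ _
        rcases List.prefix_or_prefix_of_prefix p1 p2 with p | p
        · exact hS u hu v hv p
        · exact (hS v hv u hu p).symm
      subst huv
      rw [ih L₂ (fun w hw => h₁ w (by simp [hw])) (fun w hw => h₂ w (by simp [hw]))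
        (List.append_cancel_left h)]

/-- Kraft's inequality for prefix-free codes (the empty word may be a codeword). -/
lemma kraft_of_prefixFree {α : Type} [Fintype α] [Nonempty α] (S : Finset (List α))
    (hS : ∀ u ∈ S, ∀ v ∈ S, u <+: v → u = v) :
    ∑ w ∈ S, (1 / Fintype.card α : ℝ) ^ w.length ≤ 1 := by
  -- The empty word is a prefix of everything, so it can only be the sole codeword.
  by_cases hnil : [] ∈ S
  · have : S ⊆ {[]} := fun v hv => by
      simpa using (hS [] hnil v hv (List.nil_prefix)).symm
    calc ∑ w ∈ S, (1 / Fintype.card α : ℝ) ^ w.length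
        ≤ ∑ w ∈ {([] : List α)}, (1 / Fintype.card α : ℝ) ^ w.length :=
          Finset.sum_le_sum_of_subset_of_nonneg this fun _ _ _ => by positivity
      _ = 1 := by simp
  · exact InformationTheory.kraft_mcmillan_inequality
      (uniquelyDecodable_of_prefixFree (by simpa using hnil) (by simpa using hS))

/-- The expected length of a prefix-free encoding is at least its entropy. -/
lemma unifEntropy_le_expected_length {Ω α : Type} [Fintype Ω] [Fintype α] [Nonempty α]
    (X : Ω → List α) (hX : ∀ ω ω', X ω <+: X ω' → X ω = X ω') :
    unifEntropy X ≤
      (∑ ω, ((X ω).length : ℝ)) / Fintype.card Ω * Real.log (Fintype.card α) := by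
  classical
  have hα : 0 < (Fintype.card α : ℝ) := Nat.cast_pos.2 Fintype.card_pos
  have h := unifEntropy_le_of_weight X (fun w => (1 / Fintype.card α : ℝ) ^ w.length)
    (fun ω => by positivity) (kraft_of_prefixFree _ (by
      intro u hu v hv
      obtain ⟨ω, -, rfl⟩ := Finset.mem_image.1 hu
      obtain ⟨ω', -, rfl⟩ := Finset.mem_image.1 hv
      exact hX ω ω'))
  refine h.trans (le_of_eq ?_)
  rw [div_mul_eq_mul_div, Finset.sum_mul]
  congr 1
  refine Finset.sum_congr rfl fun ω _ => ?_
  rw [Real.log_pow, one_div, Real.log_inv]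
  ring

end PrefixCode

/-! ### Summing pairwise bounds over an index range -/

section PairwiseBounds

/-- With `t = ⌊K/2⌋` and `s = K - t`, the pairs `(k, t + k)` for `k < s` and `(k, s + k)` for `k <
t` use every index exactly twice, whatever the parity of `K`. The larger index is at least `t ≥ M -
1`. -/
lemma two_mul_sum_le_of_pair_le {K M : ℕ} (hK : 2 ≤ K) (hMK : 2 * M ≤ K + 2) {a : ℕ → ℝ} {c : ℝ}
    (h : ∀ j k, j < k → k < K → M ≤ k + 1 → a j + a k ≤ c) :
    2 * ∑ k ∈ Finset.range K, a k ≤ K * c := by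
  obtain ⟨s, t, hst, hs, ht, hts⟩ : ∃ s t, K = s + t ∧ 1 ≤ t ∧ t ≤ s ∧ M ≤ t + 1 :=
    ⟨K - K / 2, K / 2, by omega, by omega, by omega, by omega⟩
  subst hst
  have e1 : ∑ k ∈ Finset.range (s + t), a k =
      ∑ k ∈ Finset.range s, a k + ∑ k ∈ Finset.range t, a (s + k) := Finset.sum_range_add _ _ _
  have e2 : ∑ k ∈ Finset.range (s + t), a k =
      ∑ k ∈ Finset.range t, a k + ∑ k ∈ Finset.range s, a (t + k) := by
    rw [add_comm s t]; exact Finset.sum_range_add _ _ _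
  have b1 : ∑ k ∈ Finset.range s, (a k + a (t + k)) ≤ s * c := by
    have := Finset.sum_le_card_nsmul (Finset.range s) (fun k => a k + a (t + k)) c (fun k hk => by
      have := Finset.mem_range.1 hk
      exact h k (t + k) (by omega) (by omega) (by omega))
    simpa using this
  have b2 : ∑ k ∈ Finset.range t, (a k + a (s + k)) ≤ t * c := by
    have := Finset.sum_le_card_nsmul (Finset.range t) (fun k => a k + a (s + k)) c (fun k hk => by
      have := Finset.mem_range.1 hk
      exact h k (s + k) (by omega) (by omega) (by omega))
    simpa using this
  rw [Finset.sum_add_distrib] at b1 b2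
  push_cast
  linarith

/-- The first `N` indices are paired with the last `N`; the middle `R` are bounded singly. -/
lemma sum_le_of_pair_le_of_le {N R : ℕ} (hNR : 1 ≤ N + R) {a : ℕ → ℝ} {c d : ℝ}
    (h : ∀ j k, j < k → k < N + R + N → N + R ≤ k → a j + a k ≤ c)
    (h' : ∀ k, k < N + R → a k ≤ d) :
    ∑ k ∈ Finset.range (N + R + N), a k ≤ N * c + R * d := by
  rw [Finset.sum_range_add, Finset.sum_range_add]
  have b1 : ∑ k ∈ Finset.range N, (a k + a (N + R + k)) ≤ N * c := by
    have := Finset.sum_le_card_nsmul (Finset.range N) (fun k => a k + a (N + R + k)) c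
      (fun k hk => by
        have := Finset.mem_range.1 hk
        exact h k (N + R + k) (by omega) (by omega) (by omega))
    simpa using this
  have b2 : ∑ k ∈ Finset.range R, a (N + k) ≤ R * d := by
    have := Finset.sum_le_card_nsmul (Finset.range R) (fun k => a (N + k)) d (fun k hk => by
      have := Finset.mem_range.1 hk
      exact h' _ (by omega))
    simpa using this
  rw [Finset.sum_add_distrib] at b1
  linarith

end PairwiseBounds

/-! ### Converse bounds for one fixed query -/

section Converse

variable {K M L : ℕ} {F : Type} [Field F] [Fintype F] {β : Type}

/-- The joint entropy of the messages indexed by `A` and of `Δ`. -/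
def jointEntropy (Δ : Messages K L F → β) (A : Finset (Fin K)) : ℝ :=
  unifEntropy fun W : Messages K L F => ((fun i : A => W i), Δ W)

lemma restrict_eq_iff {γ : Type} {A : Finset (Fin K)} {W W' : Fin K → γ} :
    ((fun i : A => W i) = fun i : A => W' i) ↔ ∀ i ∈ A, W i = W' i :=
  ⟨fun h i hi => congrFun h ⟨i, hi⟩, fun h => funext fun i => h i i.2⟩

omit [Field F] in
lemma jointEntropy_submodular (Δ : Messages K L F → β) (A B : Finset (Fin K)) :
    jointEntropy Δ (A ∪ B) + jointEntropy Δ (A ∩ B) ≤ jointEntropy Δ A + jointEntropy Δ B := by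
  refine unifEntropy_submodular ?_ ?_ ?_ <;>
    simp only [Prod.mk.injEq, restrict_eq_iff, Finset.mem_union, Finset.mem_inter] <;> grind

omit [Field F] in
lemma jointEntropy_empty (Δ : Messages K L F → β) :
    jointEntropy Δ ∅ = unifEntropy Δ :=
  unifEntropy_congr fun W W' => by
    simp only [Prod.mk.injEq, restrict_eq_iff]; simp

omit [Field F] in
lemma log_card_messages :
    Real.log (Fintype.card (Messages K L F)) = K * L * Real.log (Fintype.card F) := by
  simp [mul_assoc]

lemma jointEntropy_univ (Δ : Messages K L F → β) :
    jointEntropy Δ Finset.univ = K * L * Real.log (Fintype.card F) := by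
  rw [← log_card_messages]
  refine unifEntropy_of_injective fun W W' h => ?_
  simp only [Prod.mk.injEq, restrict_eq_iff] at h
  exact funext fun i => h.1 i (Finset.mem_univ _)

/-- If `Δ` and `X` determine the message `i`, then `H(W_i | Δ) ≤ H(X)`. -/
lemma jointEntropy_singleton_le {γ : Type} {Δ : Messages K L F → β} {X : Messages K L F → γ}
    {i : Fin K} (h : ∀ W W', Δ W = Δ W' → X W = X W' → W i = W' i) :
    jointEntropy Δ {i} ≤ jointEntropy Δ ∅ + unifEntropy X := by
  rw [jointEntropy_empty]
  refine unifEntropy_subadditive fun W W' h1 h2 => ?_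
  simp only [Prod.mk.injEq, restrict_eq_iff, Finset.mem_singleton, forall_eq]
  exact ⟨h W W' h1 h2, h1⟩

omit [Fintype F] in
lemma sideInfo_determines {S : Support K M} {c : Coeff M F} {W W' : Messages K L F} {j : Fin K}
    (hj : j ∈ S.1) (h : ∀ i ∈ S.1, i ≠ j → W i = W' i)
    (hY : sideInfo S c W = sideInfo S c W') : W j = W' j := by
  classical
  obtain ⟨m, rfl⟩ : ∃ m, S.1.orderEmbOfFin S.2 m = j := by
    have : j ∈ Set.range (S.1.orderEmbOfFin S.2) := by
      rw [Finset.range_orderEmbOfFin]; exact hj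
    exact this
  unfold sideInfo at hY
  rw [← Finset.add_sum_erase _ _ (Finset.mem_univ m),
    ← Finset.add_sum_erase _ _ (Finset.mem_univ m)] at hY
  have hrest : ∑ x ∈ Finset.univ.erase m, (c x : F) • W (S.1.orderEmbOfFin S.2 x) =
      ∑ x ∈ Finset.univ.erase m, (c x : F) • W' (S.1.orderEmbOfFin S.2 x) := by
    refine Finset.sum_congr rfl fun x hx => ?_
    rw [h _ (Finset.orderEmbOfFin_mem _ _ _)
      (fun e => (Finset.ne_of_mem_erase hx) ((S.1.orderEmbOfFin S.2).injective e))]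
  rw [hrest] at hY
  exact smul_right_injective _ (c m).ne_zero (add_right_cancel hY)

/-- All of this entropy is paid for by `H(Y | Δ)`: given `Δ`, `Y` reveals `W i`, and what remains of
`Y` must still resolve `W j` once the rest of the support is known. -/
lemma jointEntropy_pair_le {Δ : Messages K L F → β} {S : Support K M} {i j : Fin K}
    (hi : i ∈ S.1) (hj : j ∈ S.1) (hij : i ≠ j) {c : Coeff M F}
    (h : ∀ W W', Δ W = Δ W' → sideInfo S c W = sideInfo S c W' → W i = W' i) :
    jointEntropy Δ {i} - jointEntropy Δ ∅ + (jointEntropy Δ S.1 - jointEntropy Δ (S.1.erase j)) ≤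
      L * Real.log (Fintype.card F) := by
  have h1 : unifEntropy (fun W => (sideInfo S c W, Δ W)) ≤
      unifEntropy (fun W : Messages K L F => sideInfo S c W) + unifEntropy Δ :=
    unifEntropy_subadditive fun W W' h1 h2 => by rw [h1, h2]
  have h2 : unifEntropy (fun W : Messages K L F => sideInfo S c W) ≤
      L * Real.log (Fintype.card F) := by
    refine (unifEntropy_le_log_card _).trans (le_of_eq ?_)
    simp
  -- Submodularity for `(Y, Δ)` and `(W on S \ {j}, Δ)`: both determine `(W i, Δ)`, and together
  -- they determine all of `W` on `S`.
  have h3 : jointEntropy Δ S.1 + jointEntropy Δ {i} ≤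
      unifEntropy (fun W => (sideInfo S c W, Δ W)) + jointEntropy Δ (S.1.erase j) := by
    refine unifEntropy_submodular ?_ ?_ ?_ <;>
      simp only [Prod.mk.injEq, restrict_eq_iff, Finset.mem_singleton, forall_eq,
        Finset.mem_erase]
    · exact fun W W' h0 => ⟨h W W' h0.2 h0.1, h0.2⟩
    · exact fun W W' h0 => ⟨h0.1 i ⟨hij, hi⟩, h0.2⟩
    · intro W W' h0 h1
      refine ⟨fun k hk => ?_, h0.2⟩
      by_cases hkj : k = j
      · subst hkj
        exact sideInfo_determines hk (fun l hl hne => h1.1 l ⟨hne, hl⟩) h0.1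
      · exact h1.1 k ⟨hkj, hk⟩
  rw [jointEntropy_empty]
  linarith

/-- The first `k` message indices. -/
def initialIndices (K k : ℕ) : Finset (Fin K) := Finset.univ.filter fun i => i.1 < k

/-- The entropy of message `k` given `Δ` and the messages before it. -/
def chainTerm (Δ : Messages K L F → β) (k : ℕ) : ℝ :=
  jointEntropy Δ (initialIndices K (k + 1)) - jointEntropy Δ (initialIndices K k)

lemma sum_chainTerm (Δ : Messages K L F → β) :
    ∑ k ∈ Finset.range K, chainTerm Δ k =
      K * L * Real.log (Fintype.card F) - unifEntropy Δ := by
  unfold chainTerm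
  rw [Finset.sum_range_sub (fun k => jointEntropy Δ (initialIndices K k)), ← jointEntropy_univ Δ,
    ← jointEntropy_empty]
  simp [initialIndices]

omit [Field F] in
lemma chainTerm_le_singleton (Δ : Messages K L F → β) (k : Fin K) :
    chainTerm Δ k ≤ jointEntropy Δ {k} - jointEntropy Δ ∅ := by
  have h := jointEntropy_submodular Δ (initialIndices K k) {k}
  have h1 : initialIndices K k ∪ {k} = initialIndices K (k + 1) := by
    ext i; simp [initialIndices, Fin.ext_iff]; omega
  have h2 : initialIndices K k ∩ {k} = ∅ := by
    ext i; simp [initialIndices]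
  rw [h1, h2] at h
  unfold chainTerm
  linarith

-- Conditioning reduces entropy: `S.erase k` consists of indices before `k`.
omit [Field F] in
lemma chainTerm_le_of_erase_subset (Δ : Messages K L F → β) (k : Fin K) {S : Finset (Fin K)}
    (hk : k ∈ S) (hS : ∀ i ∈ S, i ≠ k → i < k) :
    chainTerm Δ k ≤ jointEntropy Δ S - jointEntropy Δ (S.erase k) := by
  have h := jointEntropy_submodular Δ (initialIndices K k) S
  have h1 : initialIndices K k ∪ S = initialIndices K (k + 1) := by
    ext i
    simp only [initialIndices, Finset.mem_union, Finset.mem_filter, Finset.mem_univ, true_and]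
    constructor
    · rintro (h | h)
      · omega
      · by_cases e : i = k
        · subst e; omega
        · have := hS i h e; omega
    · intro h
      by_cases e : i = k
      · subst e; exact Or.inr hk
      · exact Or.inl (by omega)
  have h2 : initialIndices K k ∩ S = S.erase k := by
    ext i
    simp only [initialIndices, Finset.mem_inter, Finset.mem_filter, Finset.mem_univ, true_and,
      Finset.mem_erase]
    constructor
    · rintro ⟨h, h'⟩
      exact ⟨fun e => by subst e; omega, h'⟩
    · rintro ⟨h, h'⟩
      exact ⟨hS i h' h, h'⟩
  rw [h1, h2] at h
  unfold chainTerm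
  linarith

/-- Every message of the support can be decoded from `Δ` and, for some coefficients, the value
of `f` at the side information. -/
def DecodesFrom {A : Type} (Δ : Messages K L F → β)
    (f : Support K M → Coeff M F → (Fin L → F) → A) : Prop :=
  ∀ (S : Support K M), ∀ i ∈ S.1, ∃ c : Coeff M F, ∀ W W' : Messages K L F, Δ W = Δ W' →
    f S c (sideInfo S c W) = f S c (sideInfo S c W') → W i = W' i

omit [Fintype F] in
lemma DecodesFrom.full {A : Type} {Δ : Messages K L F → β}
    {f : Support K M → Coeff M F → (Fin L → F) → A} (h : DecodesFrom Δ f) :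
    DecodesFrom (K := K) (M := M) (L := L) (F := F) Δ (fun _ _ Y => Y) := fun S i hi => by
  obtain ⟨c, hc⟩ := h S i hi
  exact ⟨c, fun W W' h1 h2 => hc W W' h1 (congrArg _ h2)⟩

/-- In a support with largest element `k`, the messages other than `k` are among those `chainTerm Δ
k` conditions on, so `jointEntropy_pair_le` applies to the two chain terms. -/
lemma chainTerm_pair_le {A : Type} {Δ : Messages K L F → β}
    {f : Support K M → Coeff M F → (Fin L → F) → A} (hM : 2 ≤ M) (hd : DecodesFrom Δ f)
    {j k : ℕ} (hjk : j < k) (hk : k < K) (hMk : M ≤ k + 1) :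
    chainTerm Δ j + chainTerm Δ k ≤ L * Real.log (Fintype.card F) := by
  let j' : Fin K := ⟨j, hjk.trans hk⟩
  let k' : Fin K := ⟨k, hk⟩
  have hcard : (initialIndices K k).card = k := by
    simp only [initialIndices]
    rw [Fin.card_filter_val_lt]
    omega
  -- `T` is the support without `k`: it needs `M - 1` of the `k` smaller indices, including `j`,
  -- which is where `M ≤ k + 1` enters.
  obtain ⟨T, hjT, hTk, hT⟩ := Finset.exists_subsuperset_card_eq (s := {j'})
    (t := initialIndices K k) (n := M - 1) (by simp [initialIndices, j', hjk]) (by simp; omega)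
    (by omega)
  have hT' : ∀ i ∈ T, i < k' := fun i hi => by
    have := hTk hi
    simp only [initialIndices, Finset.mem_filter, Finset.mem_univ, true_and] at this
    exact this
  have hkT : k' ∉ T := fun h => lt_irrefl _ (hT' _ h)
  let S : Support K M := ⟨insert k' T, by rw [Finset.card_insert_of_notMem hkT]; omega⟩
  have hjS : j' ∈ S.1 := Finset.mem_insert_of_mem (hjT (by simp))
  have hkS : k' ∈ S.1 := Finset.mem_insert_self _ _
  obtain ⟨c, hc⟩ := hd.full S j' hjS
  have h1 := jointEntropy_pair_le hjS hkS (by simp [j', k', hjk.ne]) hc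
  have h2 := chainTerm_le_singleton Δ j'
  have h3 := chainTerm_le_of_erase_subset Δ k' hkS (fun i hi hne =>
    hT' i ((Finset.mem_insert.1 hi).resolve_left hne))
  simp only [j', k'] at h1 h2 h3
  linarith

/-- Given `Δ`, the retained value of the side information already determines message `k`. -/
lemma chainTerm_le_of_usesAtMost {A : Type} {Δ : Messages K L F → β}
    {f : Support K M → Coeff M F → (Fin L → F) → A} {α : ℝ} (hL : 0 < L) (hM : 2 ≤ M)
    (hMK : M ≤ K) (hd : DecodesFrom Δ f) (hf : UsesAtMost f α) {k : ℕ} (hk : k < K) :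
    chainTerm Δ k ≤ α * (L * Real.log (Fintype.card F)) := by
  let k' : Fin K := ⟨k, hk⟩
  obtain ⟨T, hkT, -, hT⟩ := Finset.exists_subsuperset_card_eq (s := {k'})
    (t := Finset.univ) (n := M) (by simp) (by simp; omega) (by simpa using hMK)
  obtain ⟨c, hc⟩ := hd ⟨T, hT⟩ k' (hkT (by simp))
  have h1 := jointEntropy_singleton_le hc
  have h2 := hf ⟨T, hT⟩ c
  have h3 := chainTerm_le_singleton Δ k'
  have hlog : 0 < Real.log (Fintype.card F) :=
    Real.log_pos (by exact_mod_cast Fintype.one_lt_card)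
  have hL' : 0 < (L : ℝ) := Nat.cast_pos.2 hL
  rw [entropy_eq_unifEntropy, div_div, div_le_iff₀ (mul_pos hlog hL')] at h2
  simp only [k'] at h1 h3
  linarith

lemma expected_length_ge_of_sum_chainTerm_le {Δ : Messages K L F → List F}
    (hΔ : ∀ W W', Δ W <+: Δ W' → Δ W = Δ W') {b : ℝ}
    (h : ∑ k ∈ Finset.range K, chainTerm Δ k ≤ b * (L * Real.log (Fintype.card F))) :
    (K - b) * L ≤ (∑ W, ((Δ W).length : ℝ)) / Fintype.card (Messages K L F) := by
  have hlog : 0 < Real.log (Fintype.card F) :=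
    Real.log_pos (by exact_mod_cast Fintype.one_lt_card)
  have h1 := unifEntropy_le_expected_length Δ hΔ
  rw [sum_chainTerm] at h
  refine le_of_mul_le_mul_right ?_ hlog
  linarith

/-- Converse bound for small supports. -/
lemma expected_length_ge_half {A : Type} {Δ : Messages K L F → List F}
    (hΔ : ∀ W W', Δ W <+: Δ W' → Δ W = Δ W')
    {f : Support K M → Coeff M F → (Fin L → F) → A} (hM : 2 ≤ M) (hMK : M ≤ K)
    (hMK' : 2 * M ≤ K + 2) (hd : DecodesFrom Δ f) :
    (K / 2 : ℝ) * L ≤ (∑ W, ((Δ W).length : ℝ)) / Fintype.card (Messages K L F) := by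
  have h := expected_length_ge_of_sum_chainTerm_le hΔ (b := (K / 2 : ℝ)) (by
    have := two_mul_sum_le_of_pair_le (hM.trans hMK) hMK'
      (fun j k h1 h2 h3 => chainTerm_pair_le hM hd h1 h2 h3)
    linarith)
  linarith

/-- Converse bound for limited side information. -/
lemma expected_length_ge_of_usesAtMost {A : Type} {Δ : Messages K L F → List F}
    (hΔ : ∀ W W', Δ W <+: Δ W' → Δ W = Δ W')
    {f : Support K M → Coeff M F → (Fin L → F) → A} {α : ℝ} (hL : 0 < L) (hM : 2 ≤ M)
    (hMK : M ≤ K) (hd : DecodesFrom Δ f) (hf : UsesAtMost f α) :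
    (K * (1 - α) : ℝ) * L ≤ (∑ W, ((Δ W).length : ℝ)) / Fintype.card (Messages K L F) := by
  have h := expected_length_ge_of_sum_chainTerm_le hΔ (b := (K * α : ℝ)) (by
    have := Finset.sum_le_card_nsmul (Finset.range K) (chainTerm Δ) _ (fun k hk =>
      chainTerm_le_of_usesAtMost hL hM hMK hd hf (Finset.mem_range.1 hk))
    rw [Finset.card_range, nsmul_eq_mul] at this
    linarith)
  linarith

/-- Converse bound for large supports. -/
lemma expected_length_ge_of_large_support {A : Type} {Δ : Messages K L F → List F}
    (hΔ : ∀ W W', Δ W <+: Δ W' → Δ W = Δ W')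
    {f : Support K M → Coeff M F → (Fin L → F) → A} {α : ℝ} (hL : 0 < L) (hM : 2 ≤ M)
    (hMK : M ≤ K) (hMK' : K + 2 < 2 * M) (hd : DecodesFrom Δ f) (hf : UsesAtMost f α) :
    ((K - M + 1) + (2 * M - K - 2) * (1 - α) : ℝ) * L ≤
      (∑ W, ((Δ W).length : ℝ)) / Fintype.card (Messages K L F) := by
  -- `N` pairs and `R` single indices, with `K = 2N + R`; the last block starts at `N + R = M - 1`,
  -- the first index allowed as the larger member of a pair.
  obtain ⟨N, hN⟩ : ∃ N, K + 1 = M + N := ⟨K + 1 - M, by omega⟩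
  obtain ⟨R, hR⟩ : ∃ R, 2 * M = K + 2 + R := ⟨2 * M - (K + 2), by omega⟩
  have hK : K = N + R + N := by omega
  have hNr : (N : ℝ) = K - M + 1 := by
    have : (K : ℝ) + 1 = M + N := by exact_mod_cast hN
    linarith
  have hRr : (R : ℝ) = 2 * M - K - 2 := by
    have : 2 * (M : ℝ) = K + 2 + R := by exact_mod_cast hR
    linarith
  have h := expected_length_ge_of_sum_chainTerm_le hΔ (b := (N + R * α : ℝ)) (by
    have := sum_le_of_pair_le_of_le (N := N) (R := R) (by omega) (a := chainTerm Δ)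
      (fun j k h1 h2 h3 => chainTerm_pair_le hM hd h1 (by omega) (by omega))
      (fun k hk => chainTerm_le_of_usesAtMost hL hM hMK hd hf (by omega))
    rw [← hK] at this
    linarith)
  rw [hNr, hRr] at h
  refine le_trans (le_of_eq ?_) h
  ring

end Converse

/-! ### Point masses of image laws -/

section FiniteProbability

lemma map_apply_of_injective {α β : Type} (μ : PMF α) {f : α → β} (hf : Function.Injective f)
    (a : α) : μ.map f (f a) = μ a := by
  classical
  rw [PMF.map_apply, tsum_eq_single a]
  · simp
  · intro b hb
    rw [if_neg fun h => hb (hf h.symm)]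

lemma tsum_prod_eq {α β : Type} (g : α × β → ℝ≥0∞) : ∑' p, g p = ∑' a, ∑' b, g (a, b) :=
  ENNReal.tsum_prod (f := fun a b => g (a, b))

lemma map_snd_apply {α β : Type} (ν : PMF (α × β)) (b : β) :
    ν.map Prod.snd b = ∑' a, ν (a, b) := by
  classical
  rw [PMF.map_apply, tsum_prod_eq]
  refine tsum_congr fun a => ?_
  rw [tsum_eq_single b]
  · simp
  · intro b' hb
    simp [hb.symm]

end FiniteProbability

/-! ### From a scheme to its individual queries -/

namespace Scheme

variable {K M L : ℕ} {F : Type} [Field F]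

/-- The mass prescribed by `setup` does not depend on `W`, so the marginal of `W` is constant, and
total mass one fixes the constant. -/
lemma map_messages_apply [Fintype F] (Z : Scheme K M L F) (W : Messages K L F) :
    Z.law.map (fun ω => ω.W) W = (Fintype.card (Messages K L F) : ℝ≥0∞)⁻¹ := by
  classical
  have hform : ∀ W, Z.law.map (fun ω => ω.W) W = ∑' y : (Fin K × Support K M × Coeff M F),
      (Nat.card (Support K M) : ℝ≥0∞)⁻¹ * (if y.1 ∈ y.2.1.1 then (M : ℝ≥0∞)⁻¹ else 0) *
        (Nat.card (Coeff M F) : ℝ≥0∞)⁻¹ * (Nat.card (Messages K L F) : ℝ≥0∞)⁻¹ := by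
    intro W
    have h1 : Z.law.map (fun ω => ω.W) =
        (Z.law.map (fun ω => ((ω.θ, ω.S, ω.Λ), ω.W))).map Prod.snd := by
      rw [PMF.map_comp]; rfl
    rw [h1, map_snd_apply]
    refine tsum_congr fun y => ?_
    obtain ⟨θ, S, Λ⟩ := y
    rw [← Z.setup θ S Λ W, ← map_apply_of_injective (Z.law.map (fun ω => (ω.θ, ω.S, ω.Λ, ω.W)))
      (f := fun t => ((t.1, t.2.1, t.2.2.1), t.2.2.2)) (by
        rintro ⟨a, b, c, d⟩ ⟨a', b', c', d'⟩ h; simpa [and_assoc] using h), PMF.map_comp]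
    rfl
  have hconst : ∀ W', Z.law.map (fun ω => ω.W) W' = Z.law.map (fun ω => ω.W) W := fun W' => by
    rw [hform, hform]
  have hsum := (Z.law.map (fun ω => ω.W)).tsum_coe
  rw [tsum_congr hconst, tsum_fintype, Finset.sum_const, nsmul_eq_mul, mul_comm] at hsum
  exact ENNReal.eq_inv_of_mul_eq_one_left hsum

/-- The law of the query together with the demand and the side information parameters. -/
def queryLaw (Z : Scheme K M L F) : PMF (Z.Query × Fin K × Support K M × Coeff M F) :=
  Z.law.map fun ω => (ω.Q, ω.θ, ω.S, ω.Λ)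

lemma law_apply [Fintype F] (Z : Scheme K M L F) (ω : Outcome K M L F Z.Query) :
    Z.law ω = (Fintype.card (Messages K L F) : ℝ≥0∞)⁻¹ * Z.queryLaw (ω.Q, ω.θ, ω.S, ω.Λ) := by
  rw [← Z.map_messages_apply ω.W, queryLaw, ← Z.query_indep,
    ← map_apply_of_injective Z.law (f := fun ω => (ω.W, ω.Q, ω.θ, ω.S, ω.Λ))]
  rintro ⟨a, b, c, d, e⟩ ⟨a', b', c', d', e'⟩ h
  simp only [Prod.mk.injEq] at h
  simp [h]

/-- Since the messages are independent of everything else, any message realization can occur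
alongside a possible query. -/
lemma mem_support_of_queryLaw [Fintype F] (Z : Scheme K M L F) {ω : Outcome K M L F Z.Query}
    (hω : ω ∈ Z.law.support) (W : Messages K L F) :
    (⟨ω.θ, ω.S, ω.Λ, W, ω.Q⟩ : Outcome K M L F Z.Query) ∈ Z.law.support := by
  rw [PMF.mem_support_iff, law_apply] at hω ⊢
  exact hω

/-- Privacy makes the joint mass of `(θ, S)` and `(Q, W)` a product of two positive masses. -/
lemma exists_mem_support [Fintype F] (Z : Scheme K M L F) (hZ : Z.IsPrivate)
    {ω : Outcome K M L F Z.Query} (hω : ω ∈ Z.law.support) {θ : Fin K} {S : Support K M}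
    (hθ : θ ∈ S.1) :
    ∃ ω' ∈ Z.law.support, ω'.θ = θ ∧ ω'.S = S ∧ ω'.Q = ω.Q := by
  have hθS : Z.law.map (fun ω => (ω.θ, ω.S)) (θ, S) ≠ 0 := by
    -- The values `1` and `0` for `Λ` and `W` are arbitrary; `setup` gives each choice positive
    -- mass.
    have hpos : Z.law.map (fun ω => (ω.θ, ω.S, ω.Λ, ω.W)) (θ, S, 1, 0) ≠ 0 := by
      rw [Z.setup, if_pos hθ]
      have := Nat.card_pos (α := Messages K L F)
      simp
    rw [← PMF.mem_support_iff, PMF.mem_support_map_iff] at hpos ⊢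
    obtain ⟨ω', h1, h2⟩ := hpos
    simp only [Prod.mk.injEq] at h2
    exact ⟨ω', h1, by simp [h2]⟩
  have hQ : Z.law.map (fun ω => (ω.Q, ω.W)) (ω.Q, ω.W) ≠ 0 := by
    rw [← PMF.mem_support_iff, PMF.mem_support_map_iff]
    exact ⟨ω, hω, rfl⟩
  have h := mul_ne_zero hθS hQ
  rw [← hZ, ← PMF.mem_support_iff, PMF.mem_support_map_iff] at h
  obtain ⟨ω', h1, h2⟩ := h
  simp only [Prod.mk.injEq] at h2
  exact ⟨ω', h1, h2.1.1, h2.1.2, h2.2.1⟩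

lemma decodesFrom_answer [Fintype F] (Z : Scheme K M L F) (hZ : Z.IsPrivate) {A : Type}
    {f : Support K M → Coeff M F → (Fin L → F) → A} (hc : Z.IsCorrect f)
    {ω : Outcome K M L F Z.Query} (hω : ω ∈ Z.law.support) :
    DecodesFrom (Z.answer ω.Q) f := by
  intro S θ hθ
  obtain ⟨ω', h1, rfl, rfl, h4⟩ := Z.exists_mem_support hZ hω hθ
  refine ⟨ω'.Λ, fun W W' hW hY => ?_⟩
  refine hc _ (Z.mem_support_of_queryLaw h1 W) _ (Z.mem_support_of_queryLaw h1 W') ?_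
  simp only [Prod.mk.injEq, and_true]
  exact ⟨by rw [h4]; exact hW, trivial, hY⟩

/-- A lower bound on the expected answer length for each query bounds the download. -/
lemma download_ge [Fintype F] (Z : Scheme K M L F) {b : ℝ}
    (h : ∀ ω ∈ Z.law.support, b ≤
      (∑ W, ((Z.answer ω.Q W).length : ℝ)) / Fintype.card (Messages K L F)) :
    ENNReal.ofReal b ≤ Z.download := by
  have hdl : Z.download = ∑' y : Z.Query × Fin K × Support K M × Coeff M F,
      Z.queryLaw y * ((Fintype.card (Messages K L F) : ℝ≥0∞)⁻¹ *
        ∑ W, ((Z.answer y.1 W).length : ℝ≥0∞)) := by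
    let e : (Z.Query × Fin K × Support K M × Coeff M F) × Messages K L F ≃
        Outcome K M L F Z.Query :=
      { toFun := fun t => ⟨t.1.2.1, t.1.2.2.1, t.1.2.2.2, t.2, t.1.1⟩
        invFun := fun ω => ((ω.Q, ω.θ, ω.S, ω.Λ), ω.W)
        left_inv := fun _ => rfl
        right_inv := fun _ => rfl }
    unfold download
    rw [← e.tsum_eq, tsum_prod_eq]
    refine tsum_congr fun y => ?_
    rw [tsum_fintype, Finset.mul_sum, Finset.mul_sum]
    refine Finset.sum_congr rfl fun W _ => ?_
    rw [law_apply]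
    simp only [e, Equiv.coe_fn_mk]
    ring
  have hcard : (0 : ℝ) < Fintype.card (Messages K L F) := by
    exact_mod_cast Fintype.card_pos
  calc ENNReal.ofReal b = ∑' y, Z.queryLaw y * ENNReal.ofReal b := by
        rw [ENNReal.tsum_mul_right, PMF.tsum_coe, one_mul]
    _ ≤ Z.download := by
        rw [hdl]
        refine ENNReal.tsum_le_tsum fun y => ?_
        by_cases hy : Z.queryLaw y = 0
        · simp [hy]
        · rw [← ne_eq, ← PMF.mem_support_iff, queryLaw, PMF.mem_support_map_iff] at hy
          obtain ⟨ω, h1, rfl⟩ := hy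
          gcongr
          refine (ENNReal.ofReal_le_ofReal (h ω h1)).trans (le_of_eq ?_)
          rw [ENNReal.ofReal_div_of_pos hcard, ENNReal.ofReal_sum_of_nonneg (by simp),
            ENNReal.div_eq_inv_mul]
          simp

lemma rate_le [Fintype F] (Z : Scheme K M L F) (hL : 0 < L) {b : ℝ} (hb : 0 < b)
    (h : ∀ ω ∈ Z.law.support, b * L ≤
      (∑ W, ((Z.answer ω.Q W).length : ℝ)) / Fintype.card (Messages K L F)) :
    Z.rate ≤ (ENNReal.ofReal b)⁻¹ := by
  have h1 := Z.download_ge h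
  have hL0 : (L : ℝ≥0∞) ≠ 0 := by exact_mod_cast hL.ne'
  rw [ENNReal.ofReal_mul hb.le, ENNReal.ofReal_natCast] at h1
  unfold rate
  calc (L : ℝ≥0∞) / Z.download ≤ L / (ENNReal.ofReal b * L) := by gcongr
    _ = (ENNReal.ofReal b)⁻¹ := by
        rw [ENNReal.div_eq_inv_mul, ENNReal.mul_inv (Or.inr (ENNReal.natCast_ne_top L))
          (Or.inr hL0), mul_assoc, ENNReal.inv_mul_cancel hL0 (ENNReal.natCast_ne_top L), mul_one]

end Scheme

/-! ### Capacity upper bounds and monotonicity -/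

section CapacityBounds

variable {K M : ℕ}

lemma supCapacity_le (hM : 1 < M) (hMK : M ≤ K) (hMK' : 2 * M ≤ K + 2) :
    supCapacity K M ≤ (ENNReal.ofReal (K / 2))⁻¹ := by
  have hK : 0 < (K : ℝ) := by exact_mod_cast (by omega : 0 < K)
  refine iSup_le fun F => iSup_le fun _ => iSup_le fun _ => iSup_le fun L => iSup_le fun hL =>
    iSup_le fun Z => iSup_le fun hZ => iSup_le fun hc => Z.rate_le hL (by positivity) fun ω hω => ?_
  exact expected_length_ge_half (Z.prefix_free ω.Q) hM hMK hMK'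
    (Z.decodesFrom_answer hZ hc hω)

lemma supConstrainedCapacity_le {α : ℝ} (hM : 1 < M) (hMK : M ≤ K) (hα : α < 1) :
    supConstrainedCapacity K M α ≤ (ENNReal.ofReal (K * (1 - α)))⁻¹ := by
  have hK : 0 < (K : ℝ) := by exact_mod_cast (by omega : 0 < K)
  refine iSup_le fun F => iSup_le fun _ => iSup_le fun _ => iSup_le fun L => iSup_le fun hL =>
    iSup_le fun A => iSup_le fun f => iSup_le fun hf => iSup_le fun Z => iSup_le fun hZ =>
    iSup_le fun hc => Z.rate_le hL (mul_pos hK (by linarith)) fun ω hω => ?_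
  exact expected_length_ge_of_usesAtMost (Z.prefix_free ω.Q) hL hM hMK
    (Z.decodesFrom_answer hZ hc hω) hf

lemma supConstrainedCapacity_le_of_large_support {α : ℝ} (hM : 1 < M) (hMK : M ≤ K)
    (hMK' : K + 2 < 2 * M) (hα : α < 1) :
    supConstrainedCapacity K M α ≤
      (ENNReal.ofReal ((K - M + 1) + (2 * M - K - 2) * (1 - α)))⁻¹ := by
  have hMK₁ : (M : ℝ) ≤ K := by exact_mod_cast hMK
  have hMK₂ : (K : ℝ) + 2 < 2 * M := by exact_mod_cast hMK'
  refine iSup_le fun F => iSup_le fun _ => iSup_le fun _ => iSup_le fun L => iSup_le fun hL =>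
    iSup_le fun A => iSup_le fun f => iSup_le fun hf => iSup_le fun Z => iSup_le fun hZ =>
    iSup_le fun hc => Z.rate_le hL (add_pos (by linarith)
      (mul_pos (by linarith) (by linarith))) fun ω hω => ?_
  exact expected_length_ge_of_large_support (Z.prefix_free ω.Q) hL hM hMK hMK'
    (Z.decodesFrom_answer hZ hc hω) hf

lemma Scheme.IsCorrect.full {L : ℕ} {F : Type} [Field F] {Z : Scheme K M L F} {A : Type}
    {f : Support K M → Coeff M F → (Fin L → F) → A} (h : Z.IsCorrect f) :
    Z.IsCorrect (fun _ _ Y => Y) := fun ω hω ω' hω' he => h ω hω ω' hω' (by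
  simp only [Prod.mk.injEq] at he ⊢
  obtain ⟨h1, h2, h3, h4, h5, h6⟩ := he
  exact ⟨h1, h2, by rw [h3, h4, h5], h4, h5, h6⟩)

lemma supConstrainedCapacity_le_supCapacity (α : ℝ) :
    supConstrainedCapacity K M α ≤ supCapacity K M := by
  refine iSup_mono fun F => iSup_mono fun _ => iSup_mono fun _ => iSup_mono fun L =>
    iSup_mono fun hL => iSup_le fun A => iSup_le fun f => iSup_le fun _ => iSup_mono fun Z =>
    iSup_mono fun _ => ?_
  exact iSup_le fun hc => le_iSup_of_le hc.full le_rfl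

lemma usesAtMost_of_card_le {L : ℕ} {F : Type} [Field F] [Fintype F] {A : Type} [Fintype A]
    (hL : 0 < L) (f : Support K M → Coeff M F → (Fin L → F) → A) {n : ℕ}
    (hA : Fintype.card A ≤ Fintype.card F ^ n) : UsesAtMost f (n / L : ℝ) := by
  intro S c
  have hlog : 0 < Real.log (Fintype.card F) :=
    Real.log_pos (by exact_mod_cast Fintype.one_lt_card)
  have hA' : 0 < Fintype.card A := Fintype.card_pos_iff.2 ⟨f S c 0⟩
  rw [entropy_eq_unifEntropy]
  gcongr
  rw [div_le_iff₀ hlog, ← Real.log_pow]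
  refine (unifEntropy_le_log_card _).trans (Real.log_le_log (by exact_mod_cast hA') ?_)
  exact_mod_cast hA

lemma isSufficient_one : IsSufficient K M 1 := by
  refine le_antisymm (supConstrainedCapacity_le_supCapacity 1) ?_
  refine iSup_mono fun F => iSup_mono fun _ => iSup_mono fun _ => iSup_mono fun L =>
    iSup_mono fun hL => ?_
  refine le_iSup_of_le (Fin L → F) (le_iSup_of_le (fun _ _ Y => Y) (le_iSup_of_le ?_ le_rfl))
  have h := usesAtMost_of_card_le hL (K := K) (M := M) (fun _ _ (Y : Fin L → F) => Y) (n := L)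
    (by simp)
  rwa [div_self (by exact_mod_cast hL.ne')] at h

end CapacityBounds

/-! ### Independence under uniform product laws -/

section IndependenceOfProducts

lemma map_uniformOfFintype_equiv {α β : Type} [Fintype α] [Nonempty α] [Fintype β] [Nonempty β]
    (e : α ≃ β) : (PMF.uniformOfFintype α).map e = PMF.uniformOfFintype β := by
  ext b
  obtain ⟨a, rfl⟩ := e.surjective b
  rw [map_apply_of_injective _ e.injective, PMF.uniformOfFintype_apply,
    PMF.uniformOfFintype_apply, Fintype.card_congr e]

lemma indep_map_iff {Ω Ω' α β : Type} (μ : PMF Ω) (g : Ω → Ω') (X : Ω' → α) (Y : Ω' → β) :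
    Indep (μ.map g) X Y ↔ Indep μ (X ∘ g) (Y ∘ g) := by
  simp only [Indep, PMF.map_comp]
  rfl

lemma indep_uniform_prod {A B α β : Type} [Fintype A] [Nonempty A] [Fintype B] [Nonempty B]
    (X : A → α) (Y : B → β) :
    Indep (PMF.uniformOfFintype (A × B)) (fun p => X p.1) (fun p => Y p.2) := by
  classical
  have hA := (PMF.uniformOfFintype A).tsum_coe
  have hB := (PMF.uniformOfFintype B).tsum_coe
  have h : ∀ a b, PMF.uniformOfFintype (A × B) (a, b) =
      PMF.uniformOfFintype A a * PMF.uniformOfFintype B b := fun a b => by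
    simp only [PMF.uniformOfFintype_apply, Fintype.card_prod, Nat.cast_mul]
    exact ENNReal.mul_inv (Or.inr (ENNReal.natCast_ne_top _)) (Or.inl (ENNReal.natCast_ne_top _))
  intro x y
  have h1 : (PMF.uniformOfFintype (A × B)).map (fun p => (X p.1, Y p.2)) (x, y) =
      (∑' a, if x = X a then PMF.uniformOfFintype A a else 0) *
        ∑' b, if y = Y b then PMF.uniformOfFintype B b else 0 := by
    rw [PMF.map_apply, tsum_prod_eq, ← ENNReal.tsum_mul_right]
    refine tsum_congr fun a => ?_
    rw [← ENNReal.tsum_mul_left]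
    refine tsum_congr fun b => ?_
    rw [h]
    by_cases h1 : x = X a <;> by_cases h2 : y = Y b <;> simp [h1, h2]
  have h2 : (PMF.uniformOfFintype (A × B)).map (fun p => X p.1) x =
      ∑' a, if x = X a then PMF.uniformOfFintype A a else 0 := by
    rw [PMF.map_apply, tsum_prod_eq]
    refine tsum_congr fun a => ?_
    by_cases h1 : x = X a
    · simp only [h1, if_true, h]
      rw [ENNReal.tsum_mul_left, hB, mul_one]
    · simp [h1]
  have h3 : (PMF.uniformOfFintype (A × B)).map (fun p => Y p.2) y =
      ∑' b, if y = Y b then PMF.uniformOfFintype B b else 0 := by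
    rw [PMF.map_apply, tsum_prod_eq, ENNReal.tsum_comm]
    refine tsum_congr fun b => ?_
    by_cases h1 : y = Y b
    · simp only [h1, if_true, h]
      rw [ENNReal.tsum_mul_right, hA, one_mul]
    · simp [h1]
  rw [h1, h2, h3]

end IndependenceOfProducts

/-! ### Schemes whose query is a uniform key -/

section KeyedSchemes

variable {K M L : ℕ} {F : Type} [Field F]

/-- The `m`-th element of a support. -/
abbrev Support.elem (S : Support K M) (m : Fin M) : Fin K := S.1.orderEmbOfFin S.2 m

/-- The coefficients obtained by restricting a key to the support and scaling by `c`. -/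
def keyCoeff (c : Support K M → Fin M → Fin M → Fˣ) (S : Support K M) (m : Fin M)
    (d : Fin K → Fˣ) : Coeff M F := fun j => c S m j * d (S.elem j)

/-- The realization in which the demand is the `m`-th element of `S` and the query is the
key `d`. -/
def keyOutcome (c : Support K M → Fin M → Fin M → Fˣ)
    (p : (Support K M × Fin M) × ((Fin K → Fˣ) × Messages K L F)) :
    Outcome K M L F (Fin K → Fˣ) where
  θ := p.1.1.elem p.1.2
  S := p.1.1
  Λ := keyCoeff c p.1.1 p.1.2 p.2.1
  W := p.2.2
  Q := p.2.1

-- Restriction to the support is a surjective group homomorphism, so its fibres have equal size, and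
-- scaling by `c` only translates them. Hence `Λ` is uniform whatever `S` and the demand are.
open Classical in
lemma card_keyCoeff_fiber [Fintype F] (c : Support K M → Fin M → Fin M → Fˣ) (S : Support K M)
    (m : Fin M) (Λ : Coeff M F) :
    (Finset.univ.filter fun d => Λ = keyCoeff c S m d).card * Fintype.card (Coeff M F) =
      Fintype.card (Fin K → Fˣ) := by
  let ρ : (Fin K → Fˣ) →* Coeff M F :=
    { toFun := fun d j => d (S.elem j)
      map_one' := rfl
      map_mul' := fun _ _ => rfl }
  have hρ : Function.Surjective ρ :=
    ((S.1.orderEmbOfFin S.2).injective).surjective_comp_right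
  have hc : ∀ Λ', (Finset.univ.filter fun d => ρ d = Λ').card =
      (Finset.univ.filter fun d => Λ = keyCoeff c S m d).card := by
    intro Λ'
    have : (Finset.univ.filter fun d => Λ = keyCoeff c S m d) =
        Finset.univ.filter fun d => ρ d = (c S m)⁻¹ * Λ := by
      ext d
      simp only [Finset.mem_filter, Finset.mem_univ, true_and, eq_inv_mul_iff_mul_eq]
      exact eq_comm
    rw [this]
    exact MonoidHom.card_fiber_eq_of_mem_range ρ (hρ _) (hρ _)
  have h := Finset.card_eq_sum_card_fiberwise (f := ρ) (s := Finset.univ) (t := Finset.univ)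
    (by simp)
  simp only [hc, Finset.sum_const, Finset.card_univ, smul_eq_mul] at h
  rw [h, mul_comm]

variable [Fintype F] [Nonempty (Support K M)] [NeZero M]

open Classical in
lemma keyOutcome_setup (c : Support K M → Fin M → Fin M → Fˣ) (θ : Fin K) (S : Support K M)
    (Λ : Coeff M F) (W : Messages K L F) :
    ((PMF.uniformOfFintype ((Support K M × Fin M) × ((Fin K → Fˣ) × Messages K L F))).map
      (keyOutcome c)).map (fun ω => (ω.θ, ω.S, ω.Λ, ω.W)) (θ, S, Λ, W) =
    (Nat.card (Support K M) : ℝ≥0∞)⁻¹ * (if θ ∈ S.1 then (M : ℝ≥0∞)⁻¹ else 0) *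
        (Nat.card (Coeff M F) : ℝ≥0∞)⁻¹ * (Nat.card (Messages K L F) : ℝ≥0∞)⁻¹ := by
  set b : ℝ≥0∞ := (Fintype.card ((Support K M × Fin M) × ((Fin K → Fˣ) × Messages K L F)) :
    ℝ≥0∞)⁻¹ with hb
  have hcount : ((PMF.uniformOfFintype
      ((Support K M × Fin M) × ((Fin K → Fˣ) × Messages K L F))).map
      (keyOutcome c)).map (fun ω => (ω.θ, ω.S, ω.Λ, ω.W)) (θ, S, Λ, W) =
      ∑ S' : Support K M, ∑ m, ∑ d, ∑ W',
        if S = S' ∧ θ = S'.elem m ∧ Λ = keyCoeff c S' m d ∧ W = W' then b else 0 := by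
    rw [PMF.map_comp, PMF.map_apply, tsum_fintype]
    simp only [Fintype.sum_prod_type]
    refine Finset.sum_congr rfl fun S' _ => Finset.sum_congr rfl fun m _ =>
      Finset.sum_congr rfl fun d _ => Finset.sum_congr rfl fun W' _ => ?_
    rw [PMF.uniformOfFintype_apply]
    have hiff : (θ, S, Λ, W) = ((fun ω : Outcome K M L F (Fin K → Fˣ) =>
        (ω.θ, ω.S, ω.Λ, ω.W)) ∘ keyOutcome c) ((S', m), d, W') ↔
        S = S' ∧ θ = S'.elem m ∧ Λ = keyCoeff c S' m d ∧ W = W' := by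
      simp only [keyOutcome, Function.comp_apply, Prod.mk.injEq]
      tauto
    by_cases h : S = S' ∧ θ = S'.elem m ∧ Λ = keyCoeff c S' m d ∧ W = W'
    · rw [if_pos h, if_pos (hiff.2 h)]
    · rw [if_neg h, if_neg (mt hiff.1 h)]
  have hinner : ∀ m : Fin M, ∑ d, ∑ W',
      (if S = S ∧ θ = S.elem m ∧ Λ = keyCoeff c S m d ∧ W = W' then b else 0) =
      if θ = S.elem m then (Nat.card (Support K M) : ℝ≥0∞)⁻¹ * (M : ℝ≥0∞)⁻¹ *
        (Nat.card (Coeff M F) : ℝ≥0∞)⁻¹ * (Nat.card (Messages K L F) : ℝ≥0∞)⁻¹ else 0 := by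
    intro m
    have hN := card_keyCoeff_fiber c S m Λ
    set N := (Finset.univ.filter fun d => Λ = keyCoeff c S m d).card with hNdef
    have hN0 : (N : ℝ≥0∞) ≠ 0 := by
      have : 0 < Fintype.card (Fin K → Fˣ) := Fintype.card_pos
      rw [← hN] at this
      exact_mod_cast (Nat.pos_of_mul_pos_right this).ne'
    by_cases hθ : θ = S.elem m
    · have h1 : ∀ d : Fin K → Fˣ, ∑ W' : Messages K L F,
          (if S = S ∧ θ = S.elem m ∧ Λ = keyCoeff c S m d ∧ W = W' then b else 0) =
          if Λ = keyCoeff c S m d then b else 0 := by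
        intro d
        rw [Finset.sum_eq_single W (fun W' _ hW => if_neg fun h => hW h.2.2.2.symm)
          (fun h => absurd (Finset.mem_univ _) h)]
        exact if_congr (by simp [hθ]) rfl rfl
      rw [Finset.sum_congr rfl fun d _ => h1 d, if_pos hθ, ← Finset.sum_filter, Finset.sum_const, nsmul_eq_mul, ← hNdef, hb]
      simp only [Fintype.card_prod, ← hN, Nat.cast_mul, Nat.card_eq_fintype_card,
        Fintype.card_fin]
      have ht : ∀ n : ℕ, (n : ℝ≥0∞) ≠ ⊤ := ENNReal.natCast_ne_top
      have hC : (Fintype.card (Coeff M F) : ℝ≥0∞) ≠ 0 := by exact_mod_cast Fintype.card_ne_zero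
      have hW : (Fintype.card (Messages K L F) : ℝ≥0∞) ≠ 0 := by
        exact_mod_cast Fintype.card_ne_zero
      have hCt := ht (Fintype.card (Coeff M F))
      generalize (Fintype.card (Coeff M F) : ℝ≥0∞) = C at *
      rw [ENNReal.mul_inv (Or.inr (ENNReal.mul_ne_top (ENNReal.mul_ne_top (ht _) hCt) (ht _))) (Or.inr (mul_ne_zero (mul_ne_zero hN0 hC) hW)),
        ENNReal.mul_inv (Or.inr (ht _)) (Or.inl (ht _)),
        ENNReal.mul_inv (Or.inr (ht _)) (Or.inr hW),
        ENNReal.mul_inv (Or.inl hN0) (Or.inl (ht _))]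
      calc _ = ((N : ℝ≥0∞) * (N : ℝ≥0∞)⁻¹) * ((Fintype.card (Support K M) : ℝ≥0∞)⁻¹ *
            (M : ℝ≥0∞)⁻¹ * C⁻¹ * (Fintype.card (Messages K L F) : ℝ≥0∞)⁻¹) := by ring
        _ = _ := by rw [ENNReal.mul_inv_cancel hN0 (ht _), one_mul]
    · rw [if_neg hθ]
      exact Finset.sum_eq_zero fun d _ => Finset.sum_eq_zero fun W' _ =>
        if_neg fun h => hθ h.2.1
  rw [hcount, Finset.sum_eq_single S (fun S' _ hS => Finset.sum_eq_zero fun m _ =>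
      Finset.sum_eq_zero fun d _ => Finset.sum_eq_zero fun W' _ => if_neg fun h => hS h.1.symm)
      (fun h => absurd (Finset.mem_univ _) h), Finset.sum_congr rfl fun m _ => hinner m]
  by_cases hθ : θ ∈ S.1
  · obtain ⟨m, rfl⟩ : ∃ m, S.elem m = θ := by
      have : θ ∈ Set.range (S.1.orderEmbOfFin S.2) := by
        rw [Finset.range_orderEmbOfFin]; exact hθ
      exact this
    rw [if_pos hθ, Finset.sum_eq_single m (fun m' _ hm => if_neg fun h =>
      hm ((S.1.orderEmbOfFin S.2).injective h).symm) (by simp), if_pos rfl]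
  · rw [if_neg hθ, Finset.sum_eq_zero fun m _ => if_neg fun (h : θ = S.elem m) =>
      hθ (by rw [h]; exact Finset.orderEmbOfFin_mem _ _ _)]
    simp

open Classical in
/-- The scheme whose query is a uniform key and whose side information coefficients are the
scaled restriction of the key to the support. -/
def keyScheme (c : Support K M → Fin M → Fin M → Fˣ) {n : ℕ}
    (ans : (Fin K → Fˣ) → Messages K L F → List F) (hlen : ∀ d W, (ans d W).length = n) :
    Scheme K M L F where
  Query := Fin K → Fˣ
  law := (PMF.uniformOfFintype ((Support K M × Fin M) × ((Fin K → Fˣ) × Messages K L F))).map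
    (keyOutcome c)
  setup := keyOutcome_setup c
  query_indep := by
    let e : (Messages K L F × ((Support K M × Fin M) × (Fin K → Fˣ))) ≃
        ((Support K M × Fin M) × ((Fin K → Fˣ) × Messages K L F)) :=
      { toFun := fun t => (t.2.1, (t.2.2, t.1))
        invFun := fun t => (t.2.2, (t.1, t.2.1))
        left_inv := fun _ => rfl
        right_inv := fun _ => rfl }
    rw [← map_uniformOfFintype_equiv e, indep_map_iff, indep_map_iff]
    exact indep_uniform_prod (fun W : Messages K L F => W)
      (fun t : (Support K M × Fin M) × (Fin K → Fˣ) =>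
        (t.2, t.1.1.elem t.1.2, t.1.1, keyCoeff c t.1.1 t.1.2 t.2))
  answer := ans
  prefix_free := fun d W W' h => h.eq_of_length (by rw [hlen, hlen])

variable (c : Support K M → Fin M → Fin M → Fˣ) {n : ℕ}
  {ans : (Fin K → Fˣ) → Messages K L F → List F} (hlen : ∀ d W, (ans d W).length = n)

/-- The key and the messages are drawn independently of the support and the demand; only `Λ` depends
on both sides, and it is not seen by the server. -/
lemma keyScheme_isPrivate : (keyScheme c ans hlen).IsPrivate := by
  classical
  unfold Scheme.IsPrivate keyScheme
  rw [indep_map_iff]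
  exact indep_uniform_prod (fun t : Support K M × Fin M => (t.1.elem t.2, t.1))
    (fun t : (Fin K → Fˣ) × Messages K L F => t)

lemma keyScheme_isCorrect {A : Type} {f : Support K M → Coeff M F → (Fin L → F) → A}
    (h : ∀ S m d (W W' : Messages K L F), ans d W = ans d W' →
      f S (keyCoeff c S m d) (sideInfo S (keyCoeff c S m d) W) =
        f S (keyCoeff c S m d) (sideInfo S (keyCoeff c S m d) W') →
      W (S.elem m) = W' (S.elem m)) : (keyScheme c ans hlen).IsCorrect f := by
  intro ω hω ω' hω' he
  obtain ⟨p, -, rfl⟩ := (PMF.mem_support_map_iff _ _ _).1 hω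
  obtain ⟨p', -, rfl⟩ := (PMF.mem_support_map_iff _ _ _).1 hω'
  obtain ⟨⟨S, m⟩, d, W⟩ := p
  obtain ⟨⟨S', m'⟩, d', W'⟩ := p'
  simp only [keyOutcome, keyScheme, Prod.mk.injEq] at he
  obtain ⟨h1, rfl, h3, rfl, -, h6⟩ := he
  obtain rfl := (S.1.orderEmbOfFin S.2).injective h6
  exact h S m d W W' h1 h3

lemma keyScheme_rate : (keyScheme c ans hlen).rate = (L : ℝ≥0∞) / n := by
  have h : (keyScheme c ans hlen).download = n := by
    unfold Scheme.download
    have : ∀ ω : Outcome K M L F (keyScheme c ans hlen).Query, (((keyScheme c ans hlen).answer ω.Q ω.W).length : ℝ≥0∞) = n := fun ω => by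
      exact congrArg _ (hlen _ _)
    simp only [this]
    rw [ENNReal.tsum_mul_right, PMF.tsum_coe, one_mul]
  rw [Scheme.rate, h]

include hlen in
lemma le_reducedCapacity_of_keys {A : Type} {f : Support K M → Coeff M F → (Fin L → F) → A}
    (h : ∀ S m d (W W' : Messages K L F), ans d W = ans d W' →
      f S (keyCoeff c S m d) (sideInfo S (keyCoeff c S m d) W) =
        f S (keyCoeff c S m d) (sideInfo S (keyCoeff c S m d) W') →
      W (S.elem m) = W' (S.elem m)) : (L : ℝ≥0∞) / n ≤ reducedCapacity f := by
  rw [← keyScheme_rate c hlen]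
  exact le_iSup_of_le (keyScheme c ans hlen) (le_iSup_of_le (keyScheme_isPrivate c hlen)
    (le_iSup_of_le (keyScheme_isCorrect c hlen h) le_rfl))

end KeyedSchemes

/-! ### Rate `2/K` from half of the side information -/

section HalfSideInformation

variable {K M L : ℕ} {F : Type} [Field F]

/-- Scaling at the demand by `β`. -/
def demandScale {M : ℕ} (β : Fˣ) (m j : Fin M) : Fˣ := if j = m then β else 1

/-- Projections of the keyed messages and the same projection of the side information
determine the demand. -/
lemma eq_of_projections {G : Type} [AddCommGroup G] (ψ : (Fin L → F) →+ G) (β : Fˣ)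
    (hψ : ∀ y, ψ y = 0 → ψ (β • y) = 0 → y = 0) (S : Support K M) (m : Fin M)
    (d : Fin K → Fˣ) (W W' : Messages K L F) (h : ∀ k, ψ (d k • W k) = ψ (d k • W' k))
    (hY : ψ (sideInfo S (keyCoeff (fun _ => demandScale β) S m d) W) =
      ψ (sideInfo S (keyCoeff (fun _ => demandScale β) S m d) W')) :
    W (S.elem m) = W' (S.elem m) := by
  unfold sideInfo at hY
  rw [map_sum, map_sum, ← Finset.add_sum_erase _ _ (Finset.mem_univ m),
    ← Finset.add_sum_erase _ _ (Finset.mem_univ m)] at hY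
  -- Away from the demand the coefficient is the key itself, so the downloaded projections cancel
  -- these terms of the projected side information.
  have hrest : ∀ x ∈ Finset.univ.erase m, ∀ V : Messages K L F,
      (keyCoeff (fun _ => demandScale β) S m d x : F) • V (S.1.orderEmbOfFin S.2 x) =
        d (S.elem x) • V (S.elem x) := by
    intro x hx V
    simp only [keyCoeff, demandScale, if_neg (Finset.ne_of_mem_erase hx), one_mul]
    rfl
  rw [Finset.sum_congr rfl fun x hx => by rw [hrest x hx W, h, ← hrest x hx W']] at hY
  have hm : ∀ V : Messages K L F,
      (keyCoeff (fun _ => demandScale β) S m d m : F) • V (S.1.orderEmbOfFin S.2 m) =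
        β • d (S.elem m) • V (S.elem m) := by
    intro V
    simp only [keyCoeff, demandScale, if_true, smul_smul]
    rfl
  rw [hm, hm] at hY
  have h0 := hψ (d (S.elem m) • W (S.elem m) - d (S.elem m) • W' (S.elem m))
    (by rw [map_sub, h, sub_self])
    (by rw [smul_sub, map_sub, add_right_cancel hY, sub_self])
  exact smul_left_cancel _ (sub_eq_zero.1 h0)

/-- The additive map `x ↦ x + x²` in characteristic two. -/
def artinSchreier (F : Type) [Field F] [CharP F 2] : F →+ F :=
  AddMonoidHom.mk' (fun x => x + x ^ 2) fun x y => by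
    rw [CharTwo.add_sq]; ring

/-- Two symbols are projected to their images under `artinSchreier`, packed into one symbol. -/
def packedProjection [CharP F 2] (β : F) : (Fin 2 → F) →+ F :=
  AddMonoidHom.mk' (fun y => artinSchreier F (y 0) + β * artinSchreier F (y 1)) fun x y => by
    simp only [Pi.add_apply, map_add]; ring

lemma artinSchreier_apply [CharP F 2] (x : F) : artinSchreier F x = x + x ^ 2 := rfl

/-- From `x ^ 4 = x`, the element `x + x ^ 2` equals its own square. -/
lemma artinSchreier_eq_zero_or_one [CharP F 2] [Fintype F] (hF : Fintype.card F = 4) (x : F) :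
    artinSchreier F x = 0 ∨ artinSchreier F x = 1 := by
  have h4 : x ^ 4 = x := by rw [← hF]; exact FiniteField.pow_card x
  have h : artinSchreier F x * (artinSchreier F x - 1) = 0 := by
    have h2 : (2 : F) = 0 := CharTwo.two_eq_zero
    rw [artinSchreier_apply]
    linear_combination h4 + x ^ 3 * h2
  rcases mul_eq_zero.1 h with h | h
  · exact Or.inl h
  · exact Or.inr (sub_eq_zero.1 h)

lemma eq_zero_or_one_of_artinSchreier [CharP F 2] {x : F} (h : artinSchreier F x = 0) :
    x = 0 ∨ x = 1 := by
  have h' : x * (x - 1) = 0 := by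
    have h2 : (2 : F) = 0 := CharTwo.two_eq_zero
    rw [artinSchreier_apply] at h
    linear_combination h - x * h2
  rcases mul_eq_zero.1 h' with h | h
  · exact Or.inl h
  · exact Or.inr (sub_eq_zero.1 h)

/-- Both Artin–Schreier values lie in `{0, 1}`, and `1`, `β` are independent over the prime field,
so packing loses nothing. Then each `y i` and `β * y i` lies in the kernel `{0, 1}`, and `y i = 1`
would force `β` into it. -/
lemma packedProjection_kernel [CharP F 2] [Fintype F] (hF : Fintype.card F = 4) {β : F}
    (h0 : β ≠ 0) (h1 : β ≠ 1) (y : Fin 2 → F) (hy : packedProjection β y = 0)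
    (hy' : packedProjection β (β • y) = 0) : y = 0 := by
  have hcoord : ∀ z : Fin 2 → F, packedProjection β z = 0 → ∀ i, artinSchreier F (z i) = 0 := by
    intro z hz
    have hz' : artinSchreier F (z 0) + β * artinSchreier F (z 1) = 0 := hz
    have hz1 : artinSchreier F (z 1) = 0 := by
      refine (artinSchreier_eq_zero_or_one hF (z 1)).resolve_right fun h => ?_
      rw [h, mul_one] at hz'
      have hβ : β = artinSchreier F (z 0) := by
        rw [eq_neg_of_add_eq_zero_left hz', CharTwo.neg_eq]
      rcases artinSchreier_eq_zero_or_one hF (z 0) with h | h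
      · exact h0 (hβ.trans h)
      · exact h1 (hβ.trans h)
    rw [hz1, mul_zero, add_zero] at hz'
    intro i
    fin_cases i
    · exact hz'
    · exact hz1
  funext i
  refine (eq_zero_or_one_of_artinSchreier (hcoord y hy i)).resolve_right fun h => ?_
  have h' := hcoord _ hy' i
  rw [Pi.smul_apply, h, smul_eq_mul, mul_one] at h'
  rcases eq_zero_or_one_of_artinSchreier h' with h | h
  · exact h0 h
  · exact h1 h

lemma nonempty_support (hMK : M ≤ K) : Nonempty (Support K M) := by
  obtain ⟨T, -, hT⟩ := Finset.exists_subset_card_eq (s := (Finset.univ : Finset (Fin K)))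
    (n := M) (by simpa using hMK)
  exact ⟨⟨T, hT⟩⟩

lemma le_supConstrainedCapacity_half (hM : 0 < M) (hMK : M ≤ K) :
    (2 : ℝ≥0∞) / K ≤ supConstrainedCapacity K M (1 / 2) := by
  classical
  have := nonempty_support hMK
  have : NeZero M := ⟨hM.ne'⟩
  let F := GaloisField 2 2
  let _ : Fintype F := Fintype.ofFinite F
  have hF : Fintype.card F = 4 := by
    rw [← Nat.card_eq_fintype_card, GaloisField.card 2 2 (by norm_num)]; norm_num
  obtain ⟨β, hβ⟩ : ∃ β : F, β ∉ ({0, 1} : Finset F) := by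
    by_contra! h
    have := Finset.card_le_card (fun x _ => h x : (Finset.univ : Finset F) ⊆ {0, 1})
    rw [Finset.card_univ, hF] at this
    exact absurd (this.trans Finset.card_le_two) (by norm_num)
  simp only [Finset.mem_insert, Finset.mem_singleton, not_or] at hβ
  have hcap : ((2 : ℕ) : ℝ≥0∞) / K ≤ reducedCapacity (K := K) (M := M) (L := 2) (F := F)
      (fun _ _ Y => packedProjection β Y) := by
    refine le_reducedCapacity_of_keys (n := K) (fun _ => demandScale (Units.mk0 β hβ.1))
      (ans := fun d W => List.ofFn fun k => packedProjection β (d k • W k)) (by simp)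
      fun S m d W W' h hY => ?_
    refine eq_of_projections (packedProjection β) (Units.mk0 β hβ.1)
      (packedProjection_kernel hF hβ.1 hβ.2) S m d W W' ?_ hY
    exact fun k => congrFun (List.ofFn_injective h) k
  refine le_trans (by exact_mod_cast hcap) ?_
  refine le_iSup_of_le F (le_iSup_of_le inferInstance (le_iSup_of_le inferInstance
    (le_iSup_of_le 2 (le_iSup_of_le (by norm_num) (le_iSup_of_le F (le_iSup_of_le _
    (le_iSup_of_le ?_ le_rfl)))))))
  -- One retained symbol for messages of two symbols: `α = 1/2`.
  have := usesAtMost_of_card_le (K := K) (M := M) (L := 2) (by norm_num)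
    (fun _ _ Y => packedProjection β Y) (n := 1) (by simp)
  simpa using this

end HalfSideInformation

/-! ### Rate `1/(K - M + 1)` from power sums -/

section VandermondeScheme

open Polynomial

variable {K M : ℕ} {F : Type} [Field F]

/-- The polynomial vanishing exactly at the evaluation points outside `S`. -/
def locator (x : Fin K ↪ F) (S : Support K M) : F[X] := ∏ i ∈ S.1ᶜ, (X - C (x i))

lemma locator_eval_eq_zero_iff (x : Fin K ↪ F) (S : Support K M) (i : Fin K) :
    (locator x S).eval (x i) = 0 ↔ i ∉ S.1 := by
  simp [locator, eval_prod, Finset.prod_eq_zero_iff, sub_eq_zero]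

lemma natDegree_locator (x : Fin K ↪ F) (S : Support K M) : (locator x S).natDegree = K - M := by
  rw [locator, natDegree_prod_of_monic _ _ fun i _ => monic_X_sub_C _]
  simp [Finset.card_compl, S.2]

/-- The values of the locator polynomial on the support, scaled at the demand by `β`. -/
def locatorScale (x : Fin K ↪ F) (β : Fˣ) (S : Support K M) (m j : Fin M) : Fˣ :=
  demandScale β m j * Units.mk0 ((locator x S).eval (x (S.elem j)))
    (fun h => (locator_eval_eq_zero_iff x S _).1 h (Finset.orderEmbOfFin_mem _ _ _))

lemma sum_elem {G : Type} [AddCommMonoid G] (S : Support K M) (g : Fin K → G) :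
    ∑ j, g (S.elem j) = ∑ i ∈ S.1, g i := by
  conv_rhs => rw [← Finset.map_orderEmbOfFin_univ S.1 S.2]
  rw [Finset.sum_map]
  rfl

/-- The coefficients of the locator, of degree `K - M`, combine the power sums into `∑ d i * g (x i)
* W i` with `g` the locator; terms outside `S` vanish. The side information is this sum with the
demand's term multiplied by `β`, so subtracting leaves a nonzero multiple of the demand. -/
lemma eq_of_powerSums (x : Fin K ↪ F) {β : Fˣ} (hβ : (β : F) ≠ 1) (S : Support K M) (m : Fin M)
    (d : Fin K → Fˣ) (W W' : Messages K 1 F)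
    (h : ∀ r < K - M + 1, ∑ i, (d i : F) * x i ^ r * W i 0 = ∑ i, (d i : F) * x i ^ r * W' i 0)
    (hY : sideInfo S (keyCoeff (locatorScale x β) S m d) W =
      sideInfo S (keyCoeff (locatorScale x β) S m d) W') :
    W (S.elem m) = W' (S.elem m) := by
  have hcomb : ∀ V : Messages K 1 F, ∑ j : Fin M, (d (S.elem j) : F) *
      (locator x S).eval (x (S.elem j)) * V (S.elem j) 0 =
      ∑ r ∈ Finset.range (K - M + 1), (locator x S).coeff r *
        ∑ i, (d i : F) * x i ^ r * V i 0 := by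
    intro V
    rw [sum_elem S fun i => (d i : F) * (locator x S).eval (x i) * V i 0,
      Finset.sum_subset (Finset.subset_univ S.1) fun i _ hi => by
        rw [(locator_eval_eq_zero_iff x S i).2 hi]; ring]
    simp only [Finset.mul_sum]
    rw [Finset.sum_comm]
    refine Finset.sum_congr rfl fun i _ => ?_
    rw [eval_eq_sum_range' (n := K - M + 1) (by rw [natDegree_locator]; omega),
      Finset.mul_sum, Finset.sum_mul]
    exact Finset.sum_congr rfl fun r _ => by ring
  have hlin : ∑ j : Fin M, (d (S.elem j) : F) * (locator x S).eval (x (S.elem j)) *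
      W (S.elem j) 0 = ∑ j : Fin M, (d (S.elem j) : F) * (locator x S).eval (x (S.elem j)) *
      W' (S.elem j) 0 := by
    rw [hcomb, hcomb]
    exact Finset.sum_congr rfl fun r hr => by rw [h r (Finset.mem_range.1 hr)]
  have hY0 := congrFun hY 0
  have hside : ∀ V : Messages K 1 F, sideInfo S (keyCoeff (locatorScale x β) S m d) V 0 =
      ∑ j : Fin M, (d (S.elem j) : F) * (locator x S).eval (x (S.elem j)) * V (S.elem j) 0 +
        (β - 1) * ((d (S.elem m) : F) * (locator x S).eval (x (S.elem m)) * V (S.elem m) 0) := by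
    intro V
    have hterm : ∀ j : Fin M, (keyCoeff (locatorScale x β) S m d j : F) * V (S.elem j) 0 =
        (d (S.elem j) : F) * (locator x S).eval (x (S.elem j)) * V (S.elem j) 0 +
        if j = m then (β - 1) * ((d (S.elem m) : F) * (locator x S).eval (x (S.elem m)) *
          V (S.elem m) 0) else 0 := by
      intro j
      by_cases hj : j = m
      · subst hj
        simp only [keyCoeff, locatorScale, demandScale, if_true, Units.val_mul, Units.val_mk0]
        ring
      · simp only [keyCoeff, locatorScale, demandScale, if_neg hj, Units.val_mul, Units.val_mk0,
          one_mul]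
        ring
    simp only [sideInfo, Finset.sum_apply, Pi.smul_apply, smul_eq_mul]
    rw [Finset.sum_congr rfl fun j _ => hterm j, Finset.sum_add_distrib]
    simp
  rw [hside, hside, hlin] at hY0
  have h1 := mul_left_cancel₀ (sub_ne_zero.2 hβ) (add_left_cancel hY0)
  have h2 : (d (S.elem m) : F) * (locator x S).eval (x (S.elem m)) ≠ 0 :=
    mul_ne_zero (d _).ne_zero fun h =>
      (locator_eval_eq_zero_iff x S _).1 h (Finset.orderEmbOfFin_mem _ _ _)
  funext l
  rw [Subsingleton.elim l 0]
  exact mul_left_cancel₀ h2 h1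

lemma le_supCapacity (hM : 0 < M) (hMK : M ≤ K) :
    ((K - M + 1 : ℕ) : ℝ≥0∞)⁻¹ ≤ supCapacity K M := by
  classical
  have := nonempty_support hMK
  have : NeZero M := ⟨hM.ne'⟩
  -- The field must contain `K` distinct evaluation points and a unit other than `1`; here that unit
  -- is `2`.
  obtain ⟨p, hp, hprime⟩ := Nat.exists_infinite_primes (K + 3)
  have : Fact p.Prime := ⟨hprime⟩
  have hcard : Fintype.card (ZMod p) = p := ZMod.card p
  obtain ⟨x⟩ : Nonempty (Fin K ↪ ZMod p) :=
    Function.Embedding.nonempty_of_card_le (by rw [hcard, Fintype.card_fin]; omega)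
  have h2 : (2 : ZMod p) ≠ 0 := by
    have h : ((2 : ℕ) : ZMod p) ≠ 0 := by
      rw [Ne, ZMod.natCast_eq_zero_iff]
      exact fun h => absurd (Nat.le_of_dvd (by norm_num) h) (by omega)
    exact_mod_cast h
  have h1 : ((Units.mk0 2 h2 : (ZMod p)ˣ) : ZMod p) ≠ 1 := by
    rw [Units.val_mk0]
    intro h
    exact one_ne_zero (α := ZMod p) (by linear_combination h)
  have hcap : ((1 : ℕ) : ℝ≥0∞) / ((K - M + 1 : ℕ) : ℝ≥0∞) ≤
      reducedCapacity (K := K) (M := M) (L := 1) (F := ZMod p) (fun _ _ Y => Y) := by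
    refine le_reducedCapacity_of_keys (n := K - M + 1) (locatorScale x (Units.mk0 2 h2))
      (ans := fun d W => List.ofFn fun r : Fin (K - M + 1) =>
        ∑ i, (d i : ZMod p) * x i ^ r.1 * W i 0) (by simp) fun S m d W W' h hY => ?_
    exact eq_of_powerSums x h1 S m d W W' (fun r hr =>
      congrFun (List.ofFn_injective h) ⟨r, hr⟩) hY
  rw [Nat.cast_one, one_div] at hcap
  exact hcap.trans (le_iSup_of_le (ZMod p) (le_iSup_of_le inferInstance
    (le_iSup_of_le inferInstance (le_iSup_of_le 1 (le_iSup_of_le one_pos le_rfl)))))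

end VandermondeScheme

/-! ### Comparing the bounds -/

section Redundancy

variable {K M : ℕ}

lemma redundancy_of_threshold {α₀ : ℝ} (h : IsSufficient K M α₀)
    (hlt : ∀ α < α₀, supConstrainedCapacity K M α < supCapacity K M) :
    redundancy K M = 1 - α₀ ∧ IsLeast {α : ℝ | IsSufficient K M α} α₀ ∧
      ∀ α < α₀, supConstrainedCapacity K M α < supCapacity K M := by
  have hl : IsLeast {α : ℝ | IsSufficient K M α} α₀ :=
    ⟨h, fun α hα => not_lt.1 fun hlt' => (hlt α hlt').ne hα⟩
  exact ⟨by rw [redundancy, hl.csInf_eq], hl, hlt⟩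

lemma two_div_eq_inv_ofReal : (2 : ℝ≥0∞) / K = (ENNReal.ofReal (K / 2))⁻¹ := by
  rw [ENNReal.ofReal_div_of_pos two_pos, ENNReal.ofReal_natCast, ENNReal.inv_div] <;> simp

lemma isSufficient_half (hM : 1 < M) (hMK : M ≤ K) (hMK' : 2 * M ≤ K + 2) :
    IsSufficient K M (1 / 2) :=
  le_antisymm (supConstrainedCapacity_le_supCapacity _)
    ((supCapacity_le hM hMK hMK').trans
      (two_div_eq_inv_ofReal.symm.le.trans (le_supConstrainedCapacity_half (by omega) hMK)))

lemma supConstrainedCapacity_lt_of_lt_half (hM : 1 < M) (hMK : M ≤ K) {α : ℝ} (hα : α < 1 / 2) :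
    supConstrainedCapacity K M α < supCapacity K M := by
  have hK : 0 < (K : ℝ) := by exact_mod_cast (by omega : 0 < K)
  refine (supConstrainedCapacity_le hM hMK (by linarith)).trans_lt (lt_of_lt_of_le ?_
    ((le_supConstrainedCapacity_half (by omega) hMK).trans
      (supConstrainedCapacity_le_supCapacity _)))
  rw [two_div_eq_inv_ofReal, ENNReal.inv_lt_inv, ENNReal.ofReal_lt_ofReal_iff]
  · nlinarith
  · exact mul_pos hK (by linarith)

lemma supConstrainedCapacity_lt_of_lt_one (hM : 1 < M) (hMK : M ≤ K) (hMK' : K + 2 < 2 * M)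
    {α : ℝ} (hα : α < 1) : supConstrainedCapacity K M α < supCapacity K M := by
  have hMK₁ : (M : ℝ) ≤ K := by exact_mod_cast hMK
  have hMK₂ : (K : ℝ) + 2 < 2 * M := by exact_mod_cast hMK'
  refine (supConstrainedCapacity_le_of_large_support hM hMK hMK' hα).trans_lt
    (lt_of_lt_of_le ?_ (le_supCapacity (by omega) hMK))
  -- The single indices make the converse strictly exceed the download `K - M + 1` of the power-sum
  -- scheme.
  have h : 0 < (2 * M - K - 2) * (1 - α) := mul_pos (by linarith) (by linarith)
  rw [ENNReal.inv_lt_inv, ← ENNReal.ofReal_natCast, ENNReal.ofReal_lt_ofReal_iff]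
  · push_cast [hMK]
    linarith
  · linarith

end Redundancy

end PCSI

end

theorem theorem2 (K M : ℕ) (hM : 1 < M) (hMK : M ≤ K) :
    ((M : ℝ) ≤ ((K : ℝ) + 2) / 2 →
      PCSI.redundancy K M = 1 / 2 ∧
      IsLeast {α : ℝ | PCSI.IsSufficient K M α} (1 / 2) ∧
      ∀ α : ℝ, α < 1 / 2 → PCSI.supConstrainedCapacity K M α < PCSI.supCapacity K M) ∧
    (((K : ℝ) + 2) / 2 < (M : ℝ) →
      PCSI.redundancy K M = 0 ∧
      IsLeast {α : ℝ | PCSI.IsSufficient K M α} 1 ∧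
      ∀ α : ℝ, α < 1 → PCSI.supConstrainedCapacity K M α < PCSI.supCapacity K M) := by
  constructor
  · intro h
    have hMK' : 2 * M ≤ K + 2 := by
      have : 2 * (M : ℝ) ≤ K + 2 := by linarith
      exact_mod_cast this
    obtain ⟨h1, h2⟩ := PCSI.redundancy_of_threshold (PCSI.isSufficient_half hM hMK hMK')
      fun α hα => PCSI.supConstrainedCapacity_lt_of_lt_half hM hMK hα
    exact ⟨by rw [h1]; norm_num, h2⟩
  · intro h
    have hMK' : K + 2 < 2 * M := by
      have : (K : ℝ) + 2 < 2 * M := by linarith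
      exact_mod_cast this
    obtain ⟨h1, h2⟩ := PCSI.redundancy_of_threshold PCSI.isSufficient_one
      fun α hα => PCSI.supConstrainedCapacity_lt_of_lt_one hM hMK hMK' hα
    exact ⟨by rw [h1]; norm_num, h2⟩
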